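/- **Setting.** There are $N$ agents. Agent $i$ has a strategy set $\Omega_i\subset\mathbb R^n$, a cost $J_i:\mathbb R^n\times\mathbb R^n\to\mathbb R$, a matrix $C_i\in\mathbb R^{m\times n}$ and a vector $c_i\in\mathbb R^m$. Write $\boldsymbol x=\mathrm{col}(x_1,\dots,x_N)$, $\bar x=\frac1N\sum_i x_i$, $C\boldsymbol x-c=\sum_i(C_ix_i-c_i)$, $\boldsymbol\Omega=\prod_i\Omega_i$, $K=\{\boldsymbol x\in\boldsymbol\Omega: C\boldsymbol x-c\le 0\}$, and let $\bar\Omega$ be the convex hull of $\bigcup_i\Omega_i$. All norms are Euclidean (for matrices, the largest singular value). Put $$F(\boldsymbol x)=\mathrm{col}\big(\nabla_{x_i}[J_i(x_i,\tfrac1Nx_i+\tfrac1N\textstyle\sum_{j\ne i}x_j)]\big)_i,\quad F_i(v,w)=\nabla_1J_i(v,w)+\tfrac1N\nabla_2J_i(v,w),\quad \boldsymbol F(\boldsymbol v,\boldsymbol w)=\mathrm{col}(F_i(v_i,w_i))_i$$ (a partial gradient that does not exist is read as $0$). A point $\boldsymbol x^*\in K$ is a GNE if for all $i$ and all $z$ with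 $(z,\boldsymbol x^*_{-i})\in K$ one has $J_i(x_i^*,\bar x^*)\le J_i(z,\frac1Nz+\frac1N\sum_{j\ne i}x_j^*)$. It is a variational GNE (v-GNE) if moreover there is one $\lambda\in\mathbb R^m_{\ge0}$ with $0\in F(\boldsymbol x^*)_i+\mathrm N_{\Omega_i}(x_i^*)+C_i^\top\lambda$ for all $i$ and $0\le\lambda\perp-(C\boldsymbol x^*-c)\ge0$, where $\mathrm N$ is the normal cone. For $\boldsymbol\lambda=\mathrm{col}(\lambda_1,\dots,\lambda_N)\in\mathbb R^{mN}$ let $$T(\boldsymbol x,\boldsymbol\lambda)=\Big(\mathrm N_{\boldsymbol\Omega}(\boldsymbol x)+F(\boldsymbol x)+\mathrm{col}(C_i^\top\bar\lambda)_i,\ \ \mathrm N_{\mathbb R^{mN}_{\ge0}}(\boldsymbol\lambda)+\mathrm{col}\big(\lambda_i-\bar\lambda-\tfrac1N(C\boldsymbol x-c)\big)_i\Big).$$ **Assumptions.** 1. Each $\Omega_i$ is nonempty, compact and convex. For each $i$ and each $u\in\frac1N\sum_{j\ne i}\Omega_j$, the function $z\mapsto J_i(z,\frac1Nz+u)$ is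 convex and continuously differentiable on $\Omega_i$. Each $J_i$ is differentiable at every point of $\Omega_i\times\bar\Omega$. There is $\boldsymbol x\in\boldsymbol\Omega$ with $C\boldsymbol x-c<0$ componentwise. 2. For some $\chi>0$, $(F(\boldsymbol x)-F(\boldsymbol y))^\top(\boldsymbol x-\boldsymbol y)\ge\chi\|F(\boldsymbol x)-F(\boldsymbol y)\|^2$ for all $\boldsymbol x,\boldsymbol y\in\boldsymbol\Omega$. 3. $\boldsymbol F$ is Lipschitz continuous on $\boldsymbol\Omega\times\bar\Omega^N$. 4. $(\mathcal G_k)_{k\ge0}$ are undirected graphs with edge sets $\mathcal E_k$ on $\{1,\dots,N\}$ such that for some integer $Q\ge1$ the graph with edge set $\bigcup_{\ell=1}^Q\mathcal E_{k+\ell}$ is connected for every $k\ge0$. The matrices $W(k)=[w_{i,j}(k)]$ have all row and column sums equal to $1$, and for some $\varepsilon>0$ and all $k$: $w_{i,i}(k)>\varepsilon$ and, for $i\ne j$, $w_{i,j}(k)\ge\varepsilon$ if $(i,j)\in\mathcal E_k$ and $w_{i,j}(k)=0$ otherwise. 5. $0<\delta\le\min\{1,\chi\}$, $\tau>\frac1{2\delta}$,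 $0<\alpha_i\le(\|C_i\|+\tau)^{-1}$ and $0<\beta_i\le(\frac1N\sum_j\|C_j\|+\tau)^{-1}$ for all $i$. 6. $0\le\gamma^{k+1}\le\gamma^k\le1$ for all $k\ge0$, $\sum_k\gamma^k=\infty$ and $\sum_k(\gamma^k)^2<\infty$. If $\gamma^0=1$, then for some $r>0$ the map $\boldsymbol F$ is, moreover, Lipschitz continuous on $\boldsymbol\Omega\times(\bar\Omega_r)^N$, where $\bar\Omega_r$ is the open $r$-neighbourhood of $\bar\Omega$. **Algorithm.** Choose $x_i^{-1},x_i^0,\tilde x_i^{-1}\in\Omega_i$ and $\lambda_i^0\in\mathbb R^m_{\ge0}$ arbitrarily; set $\sigma_i^0=x_i^0$, $z_i^0=\lambda_i^0$, $y_i^0=2C_i\tilde x_i^{-1}-C_ix_i^{-1}-c_i$. For $k=0,1,\dots$ and all $i$: $\hat\sigma_i^k=\sum_jw_{i,j}(k)\sigma_j^k$, $\hat y_i^k=\sum_jw_{i,j}(k)y_j^k$, $\hat z_i^k=\sum_jw_{i,j}(k)z_j^k$; $$\begin{aligned}\tilde x_i^k&=\mathrm{proj}_{\Omega_i}\big(x_i^k-\alpha_i(F_i(x_i^k,\hat\sigma_i^k)+C_i^\top\hat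 z_i^k)\big),\\ y_i^{k+1}&=\hat y_i^k+C_i(2\tilde x_i^k-x_i^k)-C_i(2\tilde x_i^{k-1}-x_i^{k-1}),\\ \tilde\lambda_i^k&=\mathrm{proj}_{\mathbb R^m_{\ge0}}\big(\lambda_i^k+\beta_i(y_i^{k+1}-\lambda_i^k+\hat z_i^k)\big),\\ x_i^{k+1}&=x_i^k+\gamma^k(\tilde x_i^k-x_i^k),\qquad\lambda_i^{k+1}=\lambda_i^k+\gamma^k(\tilde\lambda_i^k-\lambda_i^k),\\ \sigma_i^{k+1}&=\hat\sigma_i^k+x_i^{k+1}-x_i^k,\qquad z_i^{k+1}=\hat z_i^k+\lambda_i^{k+1}-\lambda_i^k.\end{aligned}$$ **Theorem.** Under assumptions 1–6, if the dual sequence $(\boldsymbol\lambda^k)_{k\ge0}$ generated by the algorithm is bounded, then $(\boldsymbol x^k,\boldsymbol\lambda^k)$ converges to some $(\boldsymbol x^*,\boldsymbol\lambda^*)$ with $0\in T(\boldsymbol x^*,\boldsymbol\lambda^*)$, and $\boldsymbol x^*$ is a variational GNE. -/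

import Mathlib

open Filter Topology

noncomputable section

/-- `ℝ^d` with the Euclidean norm. -/
abbrev Vec (d : ℕ) := EuclideanSpace ℝ (Fin d)

/-- Stacked vectors `col(x_1, …, x_N)` with `x_i ∈ ℝ^d`, with the Euclidean norm of `ℝ^{dN}`. -/
abbrev Stack (N d : ℕ) := PiLp 2 (fun _ : Fin N => Vec d)

/-- The stacked vector with blocks `f i`. -/
def col {N d : ℕ} (f : Fin N → Vec d) : Stack N d := WithLp.toLp 2 f

/-- The average of the blocks. -/
def avg {N d : ℕ} (x : Stack N d) : Vec d := (1 / (N : ℝ)) • ∑ i, x i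

/-- The nonnegative orthant. -/
def orthant (m : ℕ) : Set (Vec m) := {v | ∀ k, 0 ≤ v k}

/-- The product of the sets `S i`. -/
def prodSet {N d : ℕ} (S : Fin N → Set (Vec d)) : Set (Stack N d) := {x | ∀ i, x i ∈ S i}

/-- The normal cone operator: empty off `S`, `{v | ⟪v, z - x⟫ ≤ 0 for all z ∈ S}` on `S`. -/
def normalCone {E : Type*} [NormedAddCommGroup E] [InnerProductSpace ℝ E] (S : Set E) (x : E) :
    Set E :=
  {v | x ∈ S ∧ ∀ z ∈ S, inner ℝ v (z - x) ≤ 0}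

/-- The projection onto `S`: a point of `S` nearest to `x` (unique if `S` is nonempty, closed
and convex). -/
def proj {d : ℕ} (S : Set (Vec d)) (x : Vec d) : Vec d :=
  Classical.epsilon fun y => y ∈ S ∧ ∀ z ∈ S, ‖y - x‖ ≤ ‖z - x‖

/-- The data of an aggregative game with `N` agents, strategies in `ℝ^n` and `m` affine coupling
constraints: costs `J_i(x_i, x̄)`, local sets `Ω_i`, matrices `C_i ∈ ℝ^{m×n}` (as linear maps; the
operator norm is the largest singular value and the adjoint is the transpose) and `c_i ∈ ℝ^m`. -/
structure AggGame (N n m : ℕ) where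
  J : Fin N → Vec n → Vec n → ℝ
  Ω : Fin N → Set (Vec n)
  C : Fin N → (Vec n →L[ℝ] Vec m)
  c : Fin N → Vec m

namespace AggGame

variable {N n m : ℕ} (g : AggGame N n m)

/-- `C x - c = ∑_i (C_i x_i - c_i)`. -/
def coupling (x : Stack N n) : Vec m := ∑ i, (g.C i (x i) - g.c i)

/-- The global feasible set `K`. -/
def feasible : Set (Stack N n) := {x | x ∈ prodSet g.Ω ∧ ∀ k, g.coupling x k ≤ 0}

/-- `(1/N) ∑_{j ≠ i} x_j`. -/
def others (i : Fin N) (x : Stack N n) : Vec n :=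
  (1 / (N : ℝ)) • ∑ j ∈ Finset.univ.erase i, x j

/-- The cost `z ↦ J_i(z, z/N + u)` of agent `i` as a function of its own strategy. -/
def ownCost (i : Fin N) (u : Vec n) (z : Vec n) : ℝ := g.J i z ((1 / (N : ℝ)) • z + u)

/-- `(z, x_{-i})`. -/
def deviate (i : Fin N) (x : Stack N n) (z : Vec n) : Stack N n :=
  col (Function.update (fun j => x j) i z)

/-- Generalized Nash equilibrium. -/
def IsGNE (x : Stack N n) : Prop :=
  x ∈ g.feasible ∧ ∀ i, ∀ z, deviate i x z ∈ g.feasible →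
    g.J i (x i) (avg x) ≤ g.J i z ((1 / (N : ℝ)) • z + others i x)

/-- The pseudo-gradient `F(x) = col(∇_{x_i} J_i(x_i, x̄))`; here `x̄` depends on `x_i`, too. -/
def pseudoGrad (x : Stack N n) : Stack N n :=
  col fun i => gradient (g.ownCost i (others i x)) (x i)

/-- The KKT system of the coupled problems, with multiplier `l i` for agent `i`. -/
def IsKKT (x : Stack N n) (l : Stack N m) : Prop :=
  ∀ i, (∃ v ∈ normalCone (g.Ω i) (x i),
      g.pseudoGrad x i + v + (g.C i).adjoint (l i) = 0) ∧
    l i ∈ orthant m ∧ (∀ k, g.coupling x k ≤ 0) ∧ inner ℝ (l i) (g.coupling x) = 0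

/-- Variational GNE: a GNE that satisfies the KKT system with equal multipliers. -/
def IsVariationalGNE (x : Stack N n) : Prop :=
  g.IsGNE x ∧ ∃ μ : Vec m, g.IsKKT x (col fun _ => μ)

/-- The map `F_i(v, w) = ∂J_i/∂z_1 (v, w) + (1/N) ∂J_i/∂z_2 (v, w)`. -/
def partialGrad (i : Fin N) (v w : Vec n) : Vec n :=
  gradient (fun z => g.J i z w) v + (1 / (N : ℝ)) • gradient (fun z => g.J i v z) w

/-- The extended pseudo-gradient `col(F_i(v_i, w_i))`. -/
def extPseudoGrad (v w : Stack N n) : Stack N n := col fun i => g.partialGrad i (v i) (w i)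

/-- The convex hull `Ω̄` of the union of the local sets. -/
def hull : Set (Vec n) := convexHull ℝ (⋃ i, g.Ω i)

/-- Convexity, compactness, smoothness and Slater's condition. -/
structure Standard : Prop where
  nonempty : ∀ i, (g.Ω i).Nonempty
  compact : ∀ i, IsCompact (g.Ω i)
  convex : ∀ i, Convex ℝ (g.Ω i)
  cost_convex : ∀ i, ∀ x ∈ prodSet g.Ω, ConvexOn ℝ (g.Ω i) (g.ownCost i (others i x))
  cost_diff : ∀ i, ∀ x ∈ prodSet g.Ω, ∀ z ∈ g.Ω i,
    DifferentiableAt ℝ (g.ownCost i (others i x)) z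
  cost_grad_cont : ∀ i, ∀ x ∈ prodSet g.Ω,
    ContinuousOn (gradient (g.ownCost i (others i x))) (g.Ω i)
  /-- `J_i` is differentiable in both arguments jointly, so that `F_i` is given by the partial
  gradients and `F_i(x_i, x̄) = ∇_{x_i} J_i(x_i, x̄)` by the chain rule. -/
  joint_diff : ∀ i, ∀ v ∈ g.Ω i, ∀ w ∈ g.hull,
    DifferentiableAt ℝ (fun p : Vec n × Vec n => g.J i p.1 p.2) (v, w)
  slater : ∃ x ∈ prodSet g.Ω, ∀ k, g.coupling x k < 0

/-- `F` is `χ`-cocoercive over the product of the local sets. -/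
def Cocoercive (χ : ℝ) : Prop :=
  ∀ x ∈ prodSet g.Ω, ∀ y ∈ prodSet g.Ω,
    χ * ‖g.pseudoGrad x - g.pseudoGrad y‖ ^ 2 ≤ inner ℝ (g.pseudoGrad x - g.pseudoGrad y) (x - y)

/-- The extended pseudo-gradient is Lipschitz when its first argument ranges over `∏ Ω_i` and each
block of its second argument ranges over `S`. -/
def LipschitzOver (S : Set (Vec n)) : Prop :=
  ∃ L : ℝ, 0 < L ∧ ∀ v ∈ prodSet g.Ω, ∀ u ∈ prodSet g.Ω,
    ∀ w ∈ prodSet (fun _ : Fin N => S), ∀ z ∈ prodSet (fun _ : Fin N => S),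
      ‖g.extPseudoGrad v w - g.extPseudoGrad u z‖ ≤ L * √(‖v - u‖ ^ 2 + ‖w - z‖ ^ 2)

/-- The set-valued operator `T`. Blockwise, `(C_fᵀ λ)_i = C_iᵀ ∑_j λ_j`,
`(C_f x - c_f)_i = C x - c` and `(L_m λ)_i = λ_i - λ̄`. -/
def T (x : Stack N n) (l : Stack N m) : Set (Stack N n × Stack N m) :=
  {p | ∃ a ∈ normalCone (prodSet g.Ω) x, ∃ b ∈ normalCone (prodSet fun _ : Fin N => orthant m) l,
    p.1 = a + g.pseudoGrad x + (1 / (N : ℝ)) • col (fun i => (g.C i).adjoint (∑ j, l j)) ∧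
    p.2 = b + col (fun i => l i - avg l) - (1 / (N : ℝ)) • col (fun _ => g.coupling x)}

/-- `col(x, λ) ∈ zer(T)`. -/
def IsZeroT (x : Stack N n) (l : Stack N m) : Prop := (0, 0) ∈ g.T x l

/-- The step sizes `α_i`, `β_i`, given the cocoercivity constant `χ`. -/
structure StepSizes (χ δ τ : ℝ) (α β : Fin N → ℝ) : Prop where
  δ_pos : 0 < δ
  δ_le : δ ≤ min 1 χ
  τ_gt : 1 / (2 * δ) < τ
  α_pos : ∀ i, 0 < α i
  α_le : ∀ i, α i ≤ (‖g.C i‖ + τ)⁻¹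
  β_pos : ∀ i, 0 < β i
  β_le : ∀ i, β i ≤ (1 / (N : ℝ) * ∑ j, ‖g.C j‖ + τ)⁻¹

end AggGame

/-- `Q`-connected sequence of undirected graphs. -/
def QConnected {N : ℕ} (G : ℕ → SimpleGraph (Fin N)) : Prop :=
  ∃ Q : ℕ, 1 ≤ Q ∧ ∀ k, (⨆ ℓ ∈ Finset.Icc 1 Q, G (ℓ + k)).Connected

/-- Mixing matrices for the graphs `G k`, with the lower bound `ε` uniform in `k`. -/
def IsMixing {N : ℕ} (G : ℕ → SimpleGraph (Fin N)) (W : ℕ → Matrix (Fin N) (Fin N) ℝ) : Prop :=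
  ∃ ε : ℝ, 0 < ε ∧ ∀ k,
    (∀ i j, i ≠ j → ((G k).Adj i j → ε ≤ W k i j) ∧ (¬ (G k).Adj i j → W k i j = 0)) ∧
    (∀ i, ε < W k i i) ∧
    (∀ i, ∑ j, W k i j = 1) ∧ (∀ j, ∑ i, W k i j = 1)

/-- Non-increasing in `[0,1]`, non-summable, square-summable relaxations. -/
structure VanishingSteps (γ : ℕ → ℝ) : Prop where
  nonneg : ∀ k, 0 ≤ γ k
  anti : ∀ k, γ (k + 1) ≤ γ k
  le_one : ∀ k, γ k ≤ 1
  not_summable : ¬ Summable γ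
  sq_summable : Summable fun k => γ k ^ 2

/-- The variables of the distributed algorithm at stage `k`: `x^k`, `λ^k`, the estimates `σ^k`,
`y^k`, `z^k`, and the remembered `x^{k-1}` and `x̃^{k-1}`. -/
structure AlgState (N n m : ℕ) where
  x : Stack N n
  lam : Stack N m
  σ : Stack N n
  y : Stack N m
  z : Stack N m
  xPrev : Stack N n
  xtPrev : Stack N n

/-- Distributed averaging `v_i ↦ ∑_j w_{i,j} v_j`. -/
def mix {N d : ℕ} (w : Matrix (Fin N) (Fin N) ℝ) (v : Stack N d) : Stack N d :=
  col fun i => ∑ j, w i j • v j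

namespace AggGame

variable {N n m : ℕ} (g : AggGame N n m)

/-- Initialization from `x^{-1}`, `x̃^{-1}`, `x^0`, `λ^0`. -/
def algInit (xm xtm x0 : Stack N n) (l0 : Stack N m) : AlgState N n m where
  x := x0
  lam := l0
  σ := x0
  y := col fun i => (2 : ℝ) • g.C i (xtm i) - g.C i (xm i) - g.c i
  z := l0
  xPrev := xm
  xtPrev := xtm

/-- One iteration, with step sizes `α`, `β`, mixing matrix `w` and relaxation `γ`. -/
def algStep (α β : Fin N → ℝ) (w : Matrix (Fin N) (Fin N) ℝ) (γ : ℝ) (s : AlgState N n m) :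
    AlgState N n m :=
  let σh := mix w s.σ
  let yh := mix w s.y
  let zh := mix w s.z
  let xt : Stack N n := col fun i =>
    proj (g.Ω i) (s.x i - α i • (g.partialGrad i (s.x i) (σh i) + (g.C i).adjoint (zh i)))
  let y' : Stack N m := col fun i =>
    yh i + g.C i ((2 : ℝ) • xt i - s.x i) - g.C i ((2 : ℝ) • s.xtPrev i - s.xPrev i)
  let lt : Stack N m := col fun i =>
    proj (orthant m) (s.lam i + β i • (y' i - s.lam i + zh i))
  let x' := s.x + γ • (xt - s.x)
  let l' := s.lam + γ • (lt - s.lam)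
  { x := x', lam := l', σ := σh + x' - s.x, y := y', z := zh + l' - s.lam,
    xPrev := s.x, xtPrev := xt }

/-- The sequence generated by the fully distributed algorithm. -/
def alg (α β : Fin N → ℝ) (W : ℕ → Matrix (Fin N) (Fin N) ℝ) (γ : ℕ → ℝ)
    (xm xtm x0 : Stack N n) (l0 : Stack N m) : ℕ → AlgState N n m
  | 0 => g.algInit xm xtm x0 l0
  | k + 1 => g.algStep α β (W k) (γ k) (alg α β W γ xm xtm x0 l0 k)

end AggGame

end

noncomputable section

/-! With exact averages in place of the estimates, the algorithm is a relaxed, preconditioned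
forward-backward iteration for `T`. Up to normal cones, `T` is the sum of a cocoercive map
(`forwardOp`: the pseudo-gradient and the dual disagreement) and a skew linear map (`couplingOp
(-1)`). The step-size bounds make the symmetric preconditioner `precond` at least `τ > 1 / (2δ)`
times the identity, which yields descent of its quadratic form.

The estimates add an error, the disagreement among agents. Mixing contracts disagreement
geometrically, and relaxation with bounded targets makes the increments of `x` and `λ` of order `γ`.
Hence `γ` times the error is summable, by square-summability of `γ`; see `IsTrackingBound.summable`
and `IsTrajectory.summable_consensusError`. Then `tendsto_inexact_forwardBackward` applies. It
produces a solution as a cluster point of `γ`-weighted averages (Minty's lemma upgrades weak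
solutions) and concludes by quasi-Fejér monotonicity.

One obstacle remains: the extended pseudo-gradient is Lipschitz only over the hull of the strategy
sets, which the estimates `σ` may leave. If `γ 0 < 1`, `exists_response_nonneg` shows that the
weights with which past points enter `σ` are eventually nonnegative, so `σ` returns to the hull. If
`γ 0 = 1`, the Lipschitz neighbourhood absorbs the vanishing disagreement.

Finally, at a zero of `T` all local multipliers coincide, and convexity of the costs turns the KKT
system into a variational equilibrium (`isVariationalGNE_of_isZeroT`). -/

theorem exists_tendsto_of_quasi_fejer {a b c : ℕ → ℝ} (ha : ∀ k, 0 ≤ a k) (hb : ∀ k, 0 ≤ b k)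
    (hc : ∀ k, 0 ≤ c k) (hs : Summable c) (h : ∀ k, a (k + 1) ≤ a k - b k + c k) :
    (∃ l, Tendsto a atTop (𝓝 l)) ∧ Summable b := by
  have hcs : ∀ k, ∑ j ∈ Finset.range k, c j ≤ ∑' j, c j := fun k =>
    hs.sum_le_tsum _ fun j _ => hc j
  constructor
  · have hanti : Antitone fun k => a k - ∑ j ∈ Finset.range k, c j := by
      refine antitone_nat_of_succ_le fun k => ?_
      rw [Finset.sum_range_succ]
      linarith [h k, hb k]
    have hbd : BddBelow (Set.range fun k => a k - ∑ j ∈ Finset.range k, c j) := by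
      refine ⟨-∑' j, c j, ?_⟩
      rintro _ ⟨k, rfl⟩
      have := ha k
      have := hcs k
      simp only
      linarith
    have h1 := tendsto_atTop_ciInf hanti hbd
    have h2 := h1.add hs.hasSum.tendsto_sum_nat
    exact ⟨_, by simpa using h2⟩
  · refine summable_of_sum_range_le (c := a 0 + ∑' j, c j) hb fun n => ?_
    have : ∀ n, a n + ∑ j ∈ Finset.range n, b j ≤ a 0 + ∑ j ∈ Finset.range n, c j := by
      intro n
      induction n with
      | zero => simp
      | succ n ih =>
        rw [Finset.sum_range_succ, Finset.sum_range_succ]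
        linarith [h n]
    linarith [this n, ha n, hcs n]

/-- Otherwise `γ ≤ γ f / ε` eventually, which would make `γ` summable. Smallness along a subsequence
is all that a weighted sum with such weights can give. -/
theorem frequently_lt_of_summable_mul {γ f : ℕ → ℝ} (hγ : ∀ k, 0 ≤ γ k) (hn : ¬ Summable γ)
    (hs : Summable fun k => γ k * f k) {ε : ℝ} (hε : 0 < ε) : ∃ᶠ k in atTop, f k < ε := by
  intro hcon
  apply hn
  have h1 : Summable fun k => γ k * f k / ε := hs.div_const ε
  refine Summable.of_norm_bounded_eventually_nat (g := fun k => γ k * f k / ε) h1 ?_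
  filter_upwards [hcon] with k hk
  rw [Real.norm_of_nonneg (hγ k), le_div_iff₀ hε]
  exact mul_le_mul_of_nonneg_left (not_lt.mp hk) (hγ k)

/-! ### Inexact preconditioned forward-backward iteration. -/

section ForwardBackward

variable {E : Type*} [NormedAddCommGroup E] [InnerProductSpace ℝ E]

/-- The quadratic form of `P` along one inexact preconditioned forward-backward step. -/
theorem forwardBackward_step {D : Set E} {P A : E →ₗ[ℝ] E} {B : E → E} {δ τ : ℝ}
    (hδ : 0 < δ) (hsymm : P.IsSymmetric) (hcoer : ∀ x, τ * ‖x‖ ^ 2 ≤ inner ℝ (P x) x)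
    (hskew : ∀ x, inner ℝ (A x) x = 0)
    (hB : ∀ x ∈ D, ∀ y ∈ D, δ * ‖B x - B y‖ ^ 2 ≤ inner ℝ (B x - B y) (x - y))
    {w wt v e : E} (hw : w ∈ D) (hv : v ∈ D)
    (hvi : inner ℝ (P (w - wt) - B w - A wt - e) (v - wt) ≤ 0) :
    inner ℝ (P (wt - v)) (wt - v) ≤ inner ℝ (P (w - v)) (w - v)
      - (τ - 1 / (2 * δ)) * ‖w - wt‖ ^ 2 - 2 * inner ℝ (B v + A v) (wt - v)
      + 2 * (‖e‖ * ‖wt - v‖) := by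
  obtain ⟨a, ha⟩ : ∃ a, a = w - wt := ⟨_, rfl⟩
  obtain ⟨d, hd⟩ : ∃ d, d = wt - v := ⟨_, rfl⟩
  have had : w - v = a + d := by rw [ha, hd]; abel
  have hvd : v - wt = -d := by rw [hd]; abel
  have h1 := hB w hw v hv
  rw [had, inner_add_right] at h1
  rw [hvd, ← ha, inner_neg_right, inner_sub_left, inner_sub_left, inner_sub_left] at hvi
  rw [had, ← ha, ← hd, map_add, inner_add_left, inner_add_right, inner_add_right,
    inner_add_left (B v)]
  have h2 : inner ℝ (P d) a = inner ℝ (P a) d := by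
    rw [hsymm d a, real_inner_comm]
  -- Skewness moves the operator from the new point to the reference point `v`.
  have h3 : inner ℝ (A wt) d = inner ℝ (A v) d := by
    have := hskew d
    nth_rw 1 [hd] at this
    rw [map_sub, inner_sub_left] at this
    linarith
  have h4 := hcoer a
  have h5 : inner ℝ (B w - B v) a ≤ ‖B w - B v‖ * ‖a‖ := real_inner_le_norm _ _
  have h6 : -inner ℝ e d ≤ ‖e‖ * ‖d‖ := by
    have := abs_real_inner_le_norm e d
    linarith [neg_abs_le (inner ℝ e d)]
  -- Young's inequality, weighted so that cocoercivity absorbs the first term exactly. The second,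
  -- doubled, is the `1 / (2 * δ)` lost from `τ`.
  have h7 : ‖B w - B v‖ * ‖a‖ ≤ δ * ‖B w - B v‖ ^ 2 + 1 / (4 * δ) * ‖a‖ ^ 2 := by
    have : δ * ‖B w - B v‖ ^ 2 + 1 / (4 * δ) * ‖a‖ ^ 2 - ‖B w - B v‖ * ‖a‖
        = δ * (‖B w - B v‖ - 1 / (2 * δ) * ‖a‖) ^ 2 := by
      field_simp; ring
    have h0 : 0 ≤ δ * (‖B w - B v‖ - 1 / (2 * δ) * ‖a‖) ^ 2 := by positivity
    linarith
  have h8 : (1 : ℝ) / (2 * δ) = 2 * (1 / (4 * δ)) := by field_simp; norm_num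
  have h9 : inner ℝ (B w - B v) d ≥ - (1 / (4 * δ) * ‖a‖ ^ 2) := by linarith
  rw [inner_sub_left] at h9
  rw [h8]
  nlinarith

/-- Convexity of the quadratic form: the defect is `t (1 - t)` times the form at `w - wt`. -/
theorem quadForm_relax_le {P : E →ₗ[ℝ] E} (hpos : ∀ x, 0 ≤ inner ℝ (P x) x) {t : ℝ}
    (h0 : 0 ≤ t) (h1 : t ≤ 1) (w wt v : E) :
    inner ℝ (P (w + t • (wt - w) - v)) (w + t • (wt - w) - v)
      ≤ (1 - t) * inner ℝ (P (w - v)) (w - v) + t * inner ℝ (P (wt - v)) (wt - v) := by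
  obtain ⟨a, ha⟩ : ∃ a, a = w - v := ⟨_, rfl⟩
  obtain ⟨d, hd⟩ : ∃ d, d = wt - v := ⟨_, rfl⟩
  have hk : w + t • (wt - w) - v = (1 - t) • a + t • d := by
    rw [ha, hd]; module
  have h2 := hpos (a - d)
  rw [hk, ← ha, ← hd]
  simp only [map_add, map_sub, map_smul, inner_add_left, inner_add_right, inner_sub_left,
    inner_sub_right, real_inner_smul_left, real_inner_smul_right] at h2 ⊢
  nlinarith [mul_nonneg (mul_nonneg h0 (sub_nonneg.2 h1)) h2]

/-- By Cauchy–Schwarz, `B` is `1 / δ`-Lipschitz. This supplies the continuity needed for Minty's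
lemma and for passing to cluster points. -/
theorem continuousOn_of_cocoercive {D : Set E} {B : E → E} {δ : ℝ} (hδ : 0 < δ)
    (hB : ∀ x ∈ D, ∀ y ∈ D, δ * ‖B x - B y‖ ^ 2 ≤ inner ℝ (B x - B y) (x - y)) :
    ContinuousOn B D := by
  have hl : LipschitzOnWith (Real.toNNReal (1 / δ)) B D := by
    refine LipschitzOnWith.of_dist_le_mul fun x hx y hy => ?_
    rw [Real.coe_toNNReal _ (by positivity), dist_eq_norm, dist_eq_norm]
    have h1 := (hB x hx y hy).trans (real_inner_le_norm _ _)
    rcases (norm_nonneg (B x - B y)).eq_or_lt with h | h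
    · rw [← h]; positivity
    · have : δ * ‖B x - B y‖ ≤ ‖x - y‖ := by
        refine le_of_mul_le_mul_right ?_ h
        nlinarith
      rw [one_div, inv_mul_eq_div, le_div_iff₀ hδ]
      linarith
  exact hl.continuousOn

/-- Minty's lemma: weak solutions of a variational inequality are solutions. -/
theorem minty {D : Set E} (hconv : Convex ℝ D) {H : E → E} (hH : ContinuousOn H D) {w : E}
    (hw : w ∈ D) (h : ∀ v ∈ D, inner ℝ (H v) (w - v) ≤ 0) :
    ∀ ζ ∈ D, 0 ≤ inner ℝ (H w) (ζ - w) := by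
  intro ζ hζ
  have hmem : ∀ n : ℕ, w + (1 / ((n : ℝ) + 1)) • (ζ - w) ∈ D := fun n => by
    refine hconv.add_smul_sub_mem hw hζ ⟨by positivity, ?_⟩
    rw [div_le_one (by positivity)]
    linarith [(Nat.cast_nonneg n : (0 : ℝ) ≤ n)]
  have ht : Tendsto (fun n : ℕ => w + (1 / ((n : ℝ) + 1)) • (ζ - w)) atTop (𝓝 w) := by
    have := (tendsto_one_div_add_atTop_nhds_zero_nat (𝕜 := ℝ)).smul_const (ζ - w)
    simpa using this.const_add w
  have h2 : Tendsto (fun n : ℕ => H (w + (1 / ((n : ℝ) + 1)) • (ζ - w))) atTop (𝓝 (H w)) :=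
    (hH w hw).tendsto.comp (tendsto_nhdsWithin_iff.2 ⟨ht, Eventually.of_forall hmem⟩)
  refine ge_of_tendsto (h2.inner tendsto_const_nhds) (Eventually.of_forall fun n => ?_)
  have h3 := h _ (hmem n)
  have hp : (0 : ℝ) < 1 / ((n : ℝ) + 1) := by positivity
  rw [sub_add_cancel_left, inner_neg_right, real_inner_smul_right] at h3
  by_contra hneg
  push Not at hneg
  nlinarith

variable [FiniteDimensional ℝ E]

/-- Convergence of the relaxed preconditioned forward-backward iteration with errors `e k`. No
solution is assumed to exist: weighted averages of the iterates yield one. -/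
theorem tendsto_inexact_forwardBackward {D : Set E} (hcl : IsClosed D) (hconv : Convex ℝ D)
    {P A : E →ₗ[ℝ] E} {B : E → E} {δ τ : ℝ}
    (hδ : 0 < δ) (hτ : 1 / (2 * δ) < τ) (hsymm : P.IsSymmetric)
    (hcoer : ∀ x, τ * ‖x‖ ^ 2 ≤ inner ℝ (P x) x) (hskew : ∀ x, inner ℝ (A x) x = 0)
    (hB : ∀ x ∈ D, ∀ y ∈ D, δ * ‖B x - B y‖ ^ 2 ≤ inner ℝ (B x - B y) (x - y))
    {w wt e : ℕ → E} {γ : ℕ → ℝ} {M : ℝ} (hw : ∀ k, w k ∈ D) (hwt : ∀ k, wt k ∈ D)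
    (hwM : ∀ k, ‖w k‖ ≤ M) (hwtM : ∀ k, ‖wt k‖ ≤ M)
    (hvi : ∀ k, ∀ ζ ∈ D, inner ℝ (P (w k - wt k) - B (w k) - A (wt k) - e k) (ζ - wt k) ≤ 0)
    (hstep : ∀ k, w (k + 1) = w k + γ k • (wt k - w k))
    (h0 : ∀ k, 0 ≤ γ k) (h1 : ∀ k, γ k ≤ 1) (hγ : ¬ Summable γ)
    (he : Summable fun k => γ k * ‖e k‖) :
    ∃ ws ∈ D, Tendsto w atTop (𝓝 ws) ∧ ∀ ζ ∈ D, 0 ≤ inner ℝ (B ws + A ws) (ζ - ws) := by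
  have : ProperSpace E := FiniteDimensional.proper ℝ E
  have hPc : Continuous P := P.continuous_of_finiteDimensional
  have hAc : Continuous A := A.continuous_of_finiteDimensional
  have hBc := continuousOn_of_cocoercive hδ hB
  have hHc : ContinuousOn (fun v => B v + A v) D := hBc.add hAc.continuousOn
  have hτ0 : 0 < τ := lt_trans (by positivity) hτ
  have hpos : ∀ x, 0 ≤ inner ℝ (P x) x := fun x => le_trans (by positivity) (hcoer x)
  have hκ : 0 < τ - 1 / (2 * δ) := sub_pos.2 hτ
  have hcomp : IsCompact (D ∩ Metric.closedBall 0 M) :=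
    (isCompact_closedBall 0 M).inter_left hcl
  -- The reference point `v` is arbitrary in `D`, not a solution; this lets the same estimate serve
  -- for existence and for convergence.
  have hdesc : ∀ v ∈ D, ∀ k, inner ℝ (P (w (k + 1) - v)) (w (k + 1) - v)
      ≤ inner ℝ (P (w k - v)) (w k - v) - γ k * ((τ - 1 / (2 * δ)) * ‖w k - wt k‖ ^ 2)
        - 2 * (γ k * inner ℝ (B v + A v) (wt k - v)) + 2 * (M + ‖v‖) * (γ k * ‖e k‖) := by
    intro v hv k
    have a1 := forwardBackward_step hδ hsymm hcoer hskew hB (hw k) hv (hvi k v hv)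
    have a2 := quadForm_relax_le hpos (h0 k) (h1 k) (w k) (wt k) v
    rw [← hstep] at a2
    have a3 : ‖wt k - v‖ ≤ M + ‖v‖ := (norm_sub_le _ _).trans (by linarith [hwtM k])
    have a4 := mul_le_mul_of_nonneg_left a3 (norm_nonneg (e k))
    have a5 := mul_le_mul_of_nonneg_left a1 (h0 k)
    have a6 := mul_le_mul_of_nonneg_left a4 (h0 k)
    nlinarith
  have hMnn : 0 ≤ M := (norm_nonneg _).trans (hwM 0)
  have hesum : ∀ n, ∑ k ∈ Finset.range n, γ k * ‖e k‖ ≤ ∑' k, γ k * ‖e k‖ := fun n =>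
    he.sum_le_tsum _ fun k _ => mul_nonneg (h0 k) (norm_nonneg _)
  -- existence of a solution
  have hsol : ∃ v ∈ D, ∀ ζ ∈ D, 0 ≤ inner ℝ (B v + A v) (ζ - v) := by
    have hdiv : Tendsto (fun n => ∑ k ∈ Finset.range n, γ k) atTop atTop :=
      (not_summable_iff_tendsto_nat_atTop_of_nonneg h0).1 hγ
    have hmem : ∀ᶠ n in atTop, (Finset.range n).centerMass γ wt ∈ D ∩ Metric.closedBall 0 M := by
      filter_upwards [hdiv.eventually_gt_atTop 0] with n hn
      exact (hconv.inter (convex_closedBall 0 M)).centerMass_mem (fun k _ => h0 k) hn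
        fun k _ => ⟨hwt k, by simpa using hwtM k⟩
    obtain ⟨v, hv, φ, hφ, hlim⟩ := hcomp.tendsto_subseq' hmem.frequently
    refine ⟨v, hv.1, minty hconv hHc hv.1 fun u hu => ?_⟩
    set c : ℝ := inner ℝ (P (w 0 - u)) (w 0 - u) + 2 * (M + ‖u‖) * ∑' k, γ k * ‖e k‖ with hc
    -- Telescoping gives a bound independent of `n`; division by the divergent sum of `γ` then makes
    -- the averages a weak solution in the limit.
    have hbd : ∀ n, 2 * ∑ k ∈ Finset.range n, γ k * inner ℝ (B u + A u) (wt k - u) ≤ c := by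
      intro n
      have key : inner ℝ (P (w n - u)) (w n - u)
          + 2 * ∑ k ∈ Finset.range n, γ k * inner ℝ (B u + A u) (wt k - u)
          ≤ inner ℝ (P (w 0 - u)) (w 0 - u)
            + 2 * (M + ‖u‖) * ∑ k ∈ Finset.range n, γ k * ‖e k‖ := by
        induction n with
        | zero => simp
        | succ n ih =>
          rw [Finset.sum_range_succ, Finset.sum_range_succ]
          have := hdesc u hu n
          have : 0 ≤ γ n * ((τ - 1 / (2 * δ)) * ‖w n - wt n‖ ^ 2) :=
            mul_nonneg (h0 n) (by positivity)
          linarith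
      have := hpos (w n - u)
      have := mul_le_mul_of_nonneg_left (hesum n)
        (by positivity : 0 ≤ 2 * (M + ‖u‖))
      linarith
    have hle : ∀ᶠ n in atTop, inner ℝ (B u + A u) ((Finset.range n).centerMass γ wt - u)
        ≤ c / 2 / ∑ k ∈ Finset.range n, γ k := by
      filter_upwards [hdiv.eventually_gt_atTop 0] with n hn
      rw [le_div_iff₀ hn]
      have e1 : (∑ k ∈ Finset.range n, γ k) • ((Finset.range n).centerMass γ wt - u)
          = ∑ k ∈ Finset.range n, γ k • (wt k - u) := by
        rw [Finset.centerMass, smul_sub, smul_inv_smul₀ hn.ne', Finset.sum_smul,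
          ← Finset.sum_sub_distrib]
        simp only [smul_sub]
      rw [mul_comm, ← real_inner_smul_right, e1, inner_sum]
      simp only [real_inner_smul_right]
      linarith [hbd n]
    have l1 : Tendsto (fun n => inner ℝ (B u + A u) ((Finset.range (φ n)).centerMass γ wt - u))
        atTop (𝓝 (inner ℝ (B u + A u) (v - u))) :=
      tendsto_const_nhds.inner (hlim.sub_const u)
    have l2 : Tendsto (fun n => c / 2 / ∑ k ∈ Finset.range (φ n), γ k) atTop (𝓝 0) :=
      (hdiv.comp hφ.tendsto_atTop).const_div_atTop _
    exact le_of_tendsto_of_tendsto l1 l2 (hφ.tendsto_atTop.eventually hle)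
  have hfej : ∀ v ∈ D, (∀ ζ ∈ D, 0 ≤ inner ℝ (B v + A v) (ζ - v)) →
      (∃ l, Tendsto (fun k => inner ℝ (P (w k - v)) (w k - v)) atTop (𝓝 l)) ∧
        Summable fun k => γ k * ((τ - 1 / (2 * δ)) * ‖w k - wt k‖ ^ 2) := by
    intro v hv hvs
    refine exists_tendsto_of_quasi_fejer (c := fun k => 2 * (M + ‖v‖) * (γ k * ‖e k‖))
      (fun k => hpos _) (fun k => mul_nonneg (h0 k) (by positivity))
      (fun k => mul_nonneg (by positivity) (mul_nonneg (h0 k) (norm_nonneg _)))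
      (he.mul_left _) fun k => ?_
    have := hdesc v hv k
    have := mul_nonneg (h0 k) (hvs _ (hwt k))
    linarith
  obtain ⟨v, hv, hvs⟩ := hsol
  -- Residual and error are put in one series so that a single subsequence makes both vanish; `e`
  -- itself need not tend to zero.
  have hsum : Summable fun k => γ k * ((τ - 1 / (2 * δ)) * ‖w k - wt k‖ ^ 2 + ‖e k‖) := by
    simpa only [mul_add] using (hfej v hv hvs).2.add he
  obtain ⟨φ, hφ, hφlt⟩ := extraction_forall_of_frequently fun n : ℕ =>
    frequently_lt_of_summable_mul h0 hγ hsum (ε := 1 / ((n : ℝ) + 1)) (by positivity)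
  have hlim0 : Tendsto (fun n => (τ - 1 / (2 * δ)) * ‖w (φ n) - wt (φ n)‖ ^ 2 + ‖e (φ n)‖)
      atTop (𝓝 0) :=
    squeeze_zero (fun n => by positivity) (fun n => (hφlt n).le)
      tendsto_one_div_add_atTop_nhds_zero_nat
  have hel : Tendsto (fun n => e (φ n)) atTop (𝓝 0) := by
    rw [tendsto_zero_iff_norm_tendsto_zero]
    refine squeeze_zero (fun n => norm_nonneg _) (fun n => ?_) hlim0
    have : 0 ≤ (τ - 1 / (2 * δ)) * ‖w (φ n) - wt (φ n)‖ ^ 2 := by positivity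
    linarith
  have hdl : Tendsto (fun n => w (φ n) - wt (φ n)) atTop (𝓝 0) := by
    rw [tendsto_zero_iff_norm_tendsto_zero]
    have h2 : Tendsto (fun n => ‖w (φ n) - wt (φ n)‖ ^ 2) atTop (𝓝 0) := by
      have h3 := hlim0.div_const (τ - 1 / (2 * δ))
      rw [zero_div] at h3
      refine squeeze_zero (fun n => by positivity) (fun n => ?_) h3
      rw [le_div_iff₀ hκ]
      linarith [norm_nonneg (e (φ n))]
    have h3 := h2.sqrt
    simpa [Real.sqrt_sq (norm_nonneg _)] using h3
  obtain ⟨ws, hws, ψ, hψ, hwlim⟩ := hcomp.tendsto_subseq (x := fun n => w (φ n))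
    fun n => ⟨hw _, by simpa using hwM _⟩
  have hwtlim : Tendsto (fun n => wt (φ (ψ n))) atTop (𝓝 ws) := by
    have := hwlim.sub (hdl.comp hψ.tendsto_atTop)
    simpa [Function.comp_def] using this
  have hws_sol : ∀ ζ ∈ D, 0 ≤ inner ℝ (B ws + A ws) (ζ - ws) := by
    intro ζ hζ
    have hBl : Tendsto (fun n => B (w (φ (ψ n)))) atTop (𝓝 (B ws)) :=
      (hBc ws hws.1).tendsto.comp
        (tendsto_nhdsWithin_iff.2 ⟨hwlim, Eventually.of_forall fun n => hw _⟩)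
    have hPl : Tendsto (fun n => P (w (φ (ψ n)) - wt (φ (ψ n)))) atTop (𝓝 (P 0)) :=
      (hPc.tendsto 0).comp (hdl.comp hψ.tendsto_atTop)
    have hAl : Tendsto (fun n => A (wt (φ (ψ n)))) atTop (𝓝 (A ws)) :=
      (hAc.tendsto ws).comp hwtlim
    have hl := ((((hPl.sub hBl).sub hAl).sub (hel.comp hψ.tendsto_atTop))).inner
      (hwtlim.const_sub ζ) (𝕜 := ℝ)
    have := le_of_tendsto hl (Eventually.of_forall fun n => hvi _ ζ hζ)
    rw [map_zero, zero_sub, sub_zero, ← neg_add', inner_neg_left] at this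
    linarith
  refine ⟨ws, hws.1, ?_, hws_sol⟩
  -- The form centred at the cluster point converges along the whole sequence, and its limit is read
  -- off on the subsequence.
  obtain ⟨l, hl⟩ := (hfej ws hws.1 hws_sol).1
  have hl0 : l = 0 := by
    have hq : Continuous fun x => inner ℝ (P (x - ws)) (x - ws) :=
      (hPc.comp (continuous_id.sub continuous_const)).inner (continuous_id.sub continuous_const)
    have h2 : Tendsto (fun n => inner ℝ (P (w (φ (ψ n)) - ws)) (w (φ (ψ n)) - ws)) atTop
        (𝓝 (inner ℝ (P (ws - ws)) (ws - ws))) := (hq.tendsto ws).comp hwlim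
    rw [sub_self, inner_zero_right] at h2
    exact tendsto_nhds_unique (hl.comp (hφ.comp hψ).tendsto_atTop) h2
  rw [hl0] at hl
  rw [tendsto_iff_norm_sub_tendsto_zero]
  have h2 : Tendsto (fun k => ‖w k - ws‖ ^ 2) atTop (𝓝 0) := by
    have h3 := hl.div_const τ
    rw [zero_div] at h3
    refine squeeze_zero (fun n => by positivity) (fun n => ?_) h3
    rw [le_div_iff₀ hτ0]
    linarith [hcoer (w n - ws)]
  have h3 := h2.sqrt
  simpa [Real.sqrt_sq (norm_nonneg _)] using h3

end ForwardBackward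

/-! ### Scalar recursions with geometric contraction. -/

/-- The convolution of `f` with the geometric sequence of ratio `ρ`. -/
def geomConv (ρ : ℝ) (f : ℕ → ℝ) (k : ℕ) : ℝ := ∑ r ∈ Finset.range k, ρ ^ (k - 1 - r) * f r

theorem geomConv_zero (ρ : ℝ) (f : ℕ → ℝ) : geomConv ρ f 0 = 0 := by simp [geomConv]

theorem geomConv_succ (ρ : ℝ) (f : ℕ → ℝ) (k : ℕ) :
    geomConv ρ f (k + 1) = ρ * geomConv ρ f k + f k := by
  rw [geomConv, Finset.sum_range_succ, geomConv, Finset.mul_sum]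
  congr 1
  · refine Finset.sum_congr rfl fun r hr => ?_
    rw [Finset.mem_range] at hr
    rw [show k + 1 - 1 - r = (k - 1 - r) + 1 by omega, pow_succ]
    ring
  · simp

theorem geomConv_nonneg {ρ : ℝ} (hρ : 0 ≤ ρ) {f : ℕ → ℝ} (hf : ∀ k, 0 ≤ f k) (k : ℕ) :
    0 ≤ geomConv ρ f k :=
  Finset.sum_nonneg fun r _ => mul_nonneg (pow_nonneg hρ _) (hf r)

/-- Starting late only drops nonnegative terms. This makes decay uniform in the starting time `j`.
-/
theorem geomConv_shift_le {ρ : ℝ} (hρ : 0 ≤ ρ) {f : ℕ → ℝ} (hf : ∀ k, 0 ≤ f k) (j t : ℕ) :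
    geomConv ρ (fun r => f (j + r)) t ≤ geomConv ρ f (j + t) := by
  induction t with
  | zero => rw [geomConv_zero]; exact geomConv_nonneg hρ hf _
  | succ t ih =>
    rw [← add_assoc, geomConv_succ, geomConv_succ]
    gcongr

theorem le_of_contraction {ρ B : ℝ} (hρ : 0 ≤ ρ) (hρ1 : ρ < 1) {g h : ℕ → ℝ}
    (hgh : ∀ k, g (k + 1) ≤ ρ * g k + h k) (hh : ∀ k, h k ≤ B) (k : ℕ) :
    g k ≤ |g 0| + |B| / (1 - ρ) := by
  have h1 : 0 < 1 - ρ := sub_pos.2 hρ1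
  induction k with
  | zero =>
    have : 0 ≤ |B| / (1 - ρ) := by positivity
    linarith [le_abs_self (g 0)]
  | succ k ih =>
    have h2 : |B| = (1 - ρ) * (|B| / (1 - ρ)) := by field_simp
    have h3 := mul_le_mul_of_nonneg_left ih hρ
    nlinarith [hgh k, hh k, le_abs_self B, abs_nonneg (g 0)]

theorem summable_of_contraction {ρ : ℝ} (hρ1 : ρ < 1) {g h : ℕ → ℝ}
    (hg : ∀ k, 0 ≤ g k) (hgh : ∀ k, g (k + 1) ≤ ρ * g k + h k) (hh0 : ∀ k, 0 ≤ h k)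
    (hh : Summable h) : Summable g := by
  have h1 : 0 < 1 - ρ := sub_pos.2 hρ1
  refine summable_of_sum_range_le (c := (g 0 + ∑' k, h k) / (1 - ρ)) hg fun n => ?_
  rw [le_div_iff₀ h1]
  have key : ∑ k ∈ Finset.range n, g k * (1 - ρ) + g n ≤ g 0 + ∑ k ∈ Finset.range n, h k := by
    induction n with
    | zero => simp
    | succ n ih =>
      rw [Finset.sum_range_succ, Finset.sum_range_succ]
      linarith [hgh n]
  have := hh.sum_le_tsum (Finset.range n) fun k _ => hh0 k
  rw [Finset.sum_mul]
  linarith [hg n]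

theorem tendsto_zero_of_contraction {ρ : ℝ} (hρ : 0 ≤ ρ) (hρ1 : ρ < 1) {g h : ℕ → ℝ}
    (hg : ∀ k, 0 ≤ g k) (hgh : ∀ k, g (k + 1) ≤ ρ * g k + h k)
    (hh : Tendsto h atTop (𝓝 0)) : Tendsto g atTop (𝓝 0) := by
  have h1 : 0 < 1 - ρ := sub_pos.2 hρ1
  rw [Metric.tendsto_atTop]
  intro ε hε
  obtain ⟨K, hK⟩ := eventually_atTop.1 (hh.eventually_lt_const
    (show 0 < (1 - ρ) * (ε / 2) by positivity))
  have hb : ∀ t, g (K + t) ≤ ρ ^ t * g K + ε / 2 := by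
    intro t
    induction t with
    | zero => simp; positivity
    | succ t ih =>
      have h2 := hK (K + t) (by omega)
      have h3 := mul_le_mul_of_nonneg_left ih hρ
      rw [← add_assoc, pow_succ]
      linarith [hgh (K + t)]
  have ht : Tendsto (fun t => ρ ^ t * g K) atTop (𝓝 0) := by
    simpa using (tendsto_pow_atTop_nhds_zero_of_lt_one hρ hρ1).mul_const (g K)
  obtain ⟨T, hT⟩ := eventually_atTop.1 (ht.eventually_lt_const (show 0 < ε / 2 by positivity))
  refine ⟨K + T, fun k hk => ?_⟩
  obtain ⟨t, rfl⟩ := Nat.exists_eq_add_of_le (show K ≤ k by omega)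
  rw [Real.dist_eq, sub_zero, abs_of_nonneg (hg _)]
  linarith [hb t, hT t (by omega)]

theorem tendsto_geomConv {ρ : ℝ} (hρ : 0 ≤ ρ) (hρ1 : ρ < 1) {f : ℕ → ℝ} (hf : ∀ k, 0 ≤ f k)
    (hf0 : Tendsto f atTop (𝓝 0)) : Tendsto (geomConv ρ f) atTop (𝓝 0) :=
  tendsto_zero_of_contraction hρ hρ1 (geomConv_nonneg hρ hf)
    (fun k => (geomConv_succ ρ f k).le) hf0

/-! ### Products of doubly stochastic matrices and average tracking. -/

/-- `W (j + t - 1) * ⋯ * W j`. -/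
def transition {N : ℕ} (W : ℕ → Matrix (Fin N) (Fin N) ℝ) (j : ℕ) :
    ℕ → Matrix (Fin N) (Fin N) ℝ
  | 0 => 1
  | t + 1 => W (j + t) * transition W j t

section Transition

variable {N : ℕ} {W : ℕ → Matrix (Fin N) (Fin N) ℝ}

theorem transition_add (j s t : ℕ) :
    transition W j (s + t) = transition W (j + s) t * transition W j s := by
  induction t with
  | zero => simp [transition]
  | succ t ih => rw [← add_assoc, transition, transition, ih, Matrix.mul_assoc, add_assoc]

theorem transition_nonneg (hW : ∀ k i l, 0 ≤ W k i l) (j t : ℕ) (i l : Fin N) :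
    0 ≤ transition W j t i l := by
  induction t generalizing i with
  | zero => rw [transition, Matrix.one_apply]; split_ifs <;> norm_num
  | succ t ih =>
    rw [transition, Matrix.mul_apply]
    exact Finset.sum_nonneg fun p _ => mul_nonneg (hW _ _ _) (ih p)

theorem transition_row (hW : ∀ k i, ∑ l, W k i l = 1) (j t : ℕ) (i : Fin N) :
    ∑ l, transition W j t i l = 1 := by
  induction t generalizing i with
  | zero => simp [transition, Matrix.one_apply]
  | succ t ih =>
    simp only [transition, Matrix.mul_apply]
    rw [Finset.sum_comm]
    simp only [← Finset.mul_sum, ih, mul_one, hW]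

theorem transition_col (hW : ∀ k l, ∑ i, W k i l = 1) (j t : ℕ) (l : Fin N) :
    ∑ i, transition W j t i l = 1 := by
  induction t with
  | zero => simp [transition, Matrix.one_apply]
  | succ t ih =>
    simp only [transition, Matrix.mul_apply]
    rw [Finset.sum_comm]
    simp only [← Finset.sum_mul, hW, one_mul, ih]

/-- Over sufficiently long windows every agent influences every other one. -/
theorem exists_le_transition {G : ℕ → SimpleGraph (Fin N)} (hG : QConnected G) {ε : ℝ}
    (hε : 0 < ε) (hW : ∀ k i l, 0 ≤ W k i l) (hdiag : ∀ k i, ε ≤ W k i i)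
    (hadj : ∀ k i l, (G k).Adj i l → ε ≤ W k i l) :
    ∃ T : ℕ, ∀ j i l, ε ^ T ≤ transition W j T i l := by
  obtain ⟨Q, -, hQ⟩ := hG
  -- Each window of `Q + 1` steps adds an agent to the set reached from `l`, so `N` windows suffice.
  -- The extra step per window is there because joint connectivity concerns offsets `1` to `Q`, not
  -- `0`.
  refine ⟨N * (Q + 1), fun j i l => ?_⟩
  classical
  let R : ℕ → Finset (Fin N) := fun t => {p | ε ^ t ≤ transition W j t p l}
  have hRmem : ∀ t p, p ∈ R t ↔ ε ^ t ≤ transition W j t p l := fun t p => by simp [R]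
  have hprop : ∀ t p q, ε ≤ W (j + t) q p → p ∈ R t → q ∈ R (t + 1) := by
    intro t p q hqp hp
    rw [hRmem] at hp ⊢
    rw [transition, Matrix.mul_apply, pow_succ']
    calc ε * ε ^ t ≤ W (j + t) q p * transition W j t p l := by
          gcongr
          exact hW _ _ _
      _ ≤ _ := Finset.single_le_sum
          (f := fun p => W (j + t) q p * transition W j t p l)
          (fun p _ => mul_nonneg (hW _ _ _) (transition_nonneg hW _ _ _ _)) (Finset.mem_univ p)
  have hmono : Monotone R := monotone_nat_of_le_succ fun t p hp => hprop t p p (hdiag _ _) hp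
  have hl : ∀ t, l ∈ R t := fun t =>
    hmono (Nat.zero_le t) ((hRmem 0 l).2 (by simp [transition]))
  have hgrow : ∀ t, R t ≠ Finset.univ → (R t).card < (R (t + (Q + 1))).card := by
    intro t ht
    obtain ⟨q, hq⟩ : ∃ q, q ∉ R t := by
      by_contra! hcon
      exact ht (Finset.eq_univ_iff_forall.2 hcon)
    obtain ⟨p⟩ := (hQ (j + t)).preconnected l q
    -- A walk from `l` to an unreached agent crosses the boundary of `R t` along an edge active at
    -- some time of the window; its tail is still reached then, by monotonicity.
    obtain ⟨d, -, hd1, hd2⟩ := p.exists_boundary_dart (R t : Set (Fin N)) (by exact_mod_cast hl t)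
      (by exact_mod_cast hq)
    have hda := d.adj
    simp only [SimpleGraph.iSup_adj] at hda
    obtain ⟨s, hs, hda⟩ := hda
    rw [Finset.mem_Icc] at hs
    have h1 : d.fst ∈ R (s + t) := hmono (Nat.le_add_left t s) (by exact_mod_cast hd1)
    have h2 : d.snd ∈ R (s + t + 1) := by
      refine hprop _ _ _ (hadj _ _ _ ?_) h1
      rw [show j + (s + t) = s + (j + t) by omega]
      exact hda.symm
    refine Finset.card_lt_card ((Finset.ssubset_iff_of_subset (hmono (by omega))).2
      ⟨d.snd, hmono (by omega) h2, by exact_mod_cast hd2⟩)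
  have hcard : ∀ s, R (s * (Q + 1)) = Finset.univ ∨ s < (R (s * (Q + 1))).card := by
    intro s
    induction s with
    | zero => exact Or.inr (Finset.card_pos.2 ⟨l, hl _⟩)
    | succ s ih =>
      rw [Nat.succ_mul]
      by_cases h : R (s * (Q + 1)) = Finset.univ
      · left
        exact Finset.eq_univ_of_forall fun p => hmono (Nat.le_add_right _ _) (h ▸ Finset.mem_univ p)
      · right
        have := hgrow _ h
        have := ih.resolve_left h
        omega
  have huniv : R (N * (Q + 1)) = Finset.univ := by
    refine (hcard N).resolve_right fun h => ?_
    have := Finset.card_le_univ (R (N * (Q + 1)))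
    rw [Fintype.card_fin] at this
    omega
  exact (hRmem _ _).1 (huniv ▸ Finset.mem_univ i)

/-- Columns of a product minus `1 / N` sum to zero, so `κ` can be subtracted from every entry of the
next `T`-step factor for free. What remains has nonnegative entries and row sums `1 - N κ`, a
contraction. -/
theorem exists_abs_transition_sub_le [NeZero N] {T : ℕ} {κ : ℝ} (hκ : 0 < κ)
    (hW : ∀ k i l, 0 ≤ W k i l) (hrow : ∀ k i, ∑ l, W k i l = 1) (hcol : ∀ k l, ∑ i, W k i l = 1)
    (hT : ∀ j i l, κ ≤ transition W j T i l) :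
    ∃ C ρ : ℝ, 0 < C ∧ 0 < ρ ∧ ρ < 1 ∧
      ∀ j t i l, |transition W j t i l - 1 / (N : ℝ)| ≤ C * ρ ^ t := by
  have hN : (1 : ℝ) ≤ N := by exact_mod_cast Nat.one_le_iff_ne_zero.2 (NeZero.ne N)
  have hN0 : (0 : ℝ) < N := by linarith
  have hTr := transition_row hrow
  have hTc := transition_col hcol
  have hTn := transition_nonneg hW
  -- The maximum keeps `θ` positive even when `N κ = 1`.
  set θ : ℝ := max (1 - N * κ) (1 / 2) with hθ
  have hθ1 : θ < 1 := max_lt (by nlinarith) (by norm_num)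
  have hθ2 : 1 / 2 ≤ θ := le_max_right _ _
  have hle1 : ∀ j t i l, transition W j t i l ≤ 1 := fun j t i l => by
    rw [← hTr j t i]
    exact Finset.single_le_sum (f := fun l => transition W j t i l) (fun p _ => hTn j t i p)
      (Finset.mem_univ l)
  have hpow : ∀ j s r i l, |transition W j (r + s * T) i l - 1 / (N : ℝ)| ≤ θ ^ s := by
    intro j s r
    induction s with
    | zero =>
      intro i l
      have h1 := hTn j (r + 0 * T) i l
      have h2 := hle1 j (r + 0 * T) i l
      have h3 : 1 / (N : ℝ) ≤ 1 := by rw [div_le_one hN0]; exact hN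
      have h4 : 0 < 1 / (N : ℝ) := by positivity
      rw [pow_zero, abs_le]
      constructor <;> linarith
    | succ s ih =>
      intro i l
      rw [Nat.succ_mul, ← add_assoc, transition_add, Matrix.mul_apply]
      set A := transition W (j + (r + s * T)) T
      have e1 : ∑ p, A i p * transition W j (r + s * T) p l - 1 / (N : ℝ)
          = ∑ p, (A i p - κ) * (transition W j (r + s * T) p l - 1 / (N : ℝ)) := by
        have h1 : ∑ p, A i p = 1 := hTr _ _ _
        have h2 : ∑ p, transition W j (r + s * T) p l = 1 := hTc _ _ _
        simp only [sub_mul, mul_sub, Finset.sum_sub_distrib, ← Finset.sum_mul, ← Finset.mul_sum,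
          h1, h2, Finset.sum_const, Finset.card_univ, Fintype.card_fin, nsmul_eq_mul]
        field_simp
        ring
      rw [e1]
      calc |∑ p, (A i p - κ) * (transition W j (r + s * T) p l - 1 / (N : ℝ))|
          ≤ ∑ p, (A i p - κ) * θ ^ s := by
            refine (Finset.abs_sum_le_sum_abs _ _).trans (Finset.sum_le_sum fun p _ => ?_)
            rw [abs_mul, abs_of_nonneg (sub_nonneg.2 (hT _ _ _))]
            exact mul_le_mul_of_nonneg_left (ih p l) (sub_nonneg.2 (hT _ _ _))
        _ = (1 - N * κ) * θ ^ s := by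
            rw [← Finset.sum_mul, Finset.sum_sub_distrib, hTr]
            simp
        _ ≤ θ ^ (s + 1) := by
            rw [pow_succ']
            exact mul_le_mul_of_nonneg_right (le_max_left _ _) (by positivity)
  -- For `T = 0` the bound `θ ^ s` holds for all `s` on the same matrix, so the deviation is zero.
  rcases Nat.eq_zero_or_pos T with rfl | hTpos
  · refine ⟨1, 1 / 2, one_pos, by norm_num, by norm_num, fun j t i l => ?_⟩
    have h0 : Tendsto (fun s => θ ^ s) atTop (𝓝 0) :=
      tendsto_pow_atTop_nhds_zero_of_lt_one (by linarith) hθ1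
    have h1 : |transition W j t i l - 1 / (N : ℝ)| ≤ 0 :=
      ge_of_tendsto h0 (Eventually.of_forall fun s => by simpa using hpow j s t i l)
    exact h1.trans (by positivity)
  have hT1 : (1 : ℝ) ≤ T := by exact_mod_cast hTpos
  -- By Bernoulli, `θ ≤ ρ ^ T`, so this replaces the root of order `T`. The constant `1 / ρ ^ T`
  -- pays for the incomplete last window.
  set ρ : ℝ := 1 - (1 - θ) / T with hρ
  have hd1 : (1 - θ) / T ≤ 1 / 2 := by
    rw [div_le_iff₀ (by linarith)]; nlinarith
  have hd2 : 0 < (1 - θ) / T := div_pos (by linarith) (by linarith)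
  have hρ0 : 0 < ρ := by linarith
  have hρ1 : ρ < 1 := by linarith
  have hθρ : θ ≤ ρ ^ T := by
    have h := one_add_mul_le_pow (a := -((1 - θ) / T)) (by linarith) T
    have h2 : 1 + (T : ℝ) * -((1 - θ) / T) = θ := by field_simp; ring
    rw [h2] at h
    rwa [hρ, sub_eq_add_neg]
  refine ⟨1 / ρ ^ T, ρ, by positivity, hρ0, hρ1, fun j t i l => ?_⟩
  have hdm := Nat.mod_add_div' t T
  have h1 := hpow j (t / T) (t % T) i l
  rw [hdm] at h1
  refine h1.trans ?_
  calc θ ^ (t / T) ≤ (ρ ^ T) ^ (t / T) := by gcongr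
    _ = ρ ^ (t / T * T) := by rw [← pow_mul, mul_comm]
    _ ≤ 1 / ρ ^ T * ρ ^ t := by
      rw [one_div, inv_mul_eq_div, le_div_iff₀ (by positivity), ← pow_add]
      refine pow_le_pow_of_le_one hρ0.le hρ1.le ?_
      have := Nat.mod_lt t hTpos
      omega

/-- Variation of constants: input `u r` enters after the matrix `W (j + r)` has acted, so it is
propagated from time `j + r + 1` on. -/
theorem solution_eq_transition {V : Type*} [AddCommGroup V] [Module ℝ V] {j : ℕ}
    {v u : ℕ → Fin N → V} (hv : ∀ t i, v (t + 1) i = ∑ l, W (j + t) i l • v t l + u t i)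
    (t : ℕ) (i : Fin N) :
    v t i = ∑ l, transition W j t i l • v 0 l
      + ∑ r ∈ Finset.range t, ∑ l, transition W (j + r + 1) (t - 1 - r) i l • u r l := by
  induction t generalizing i with
  | zero => simp [transition, Matrix.one_apply]
  | succ t ih =>
    have hmul : ∀ (A : Matrix (Fin N) (Fin N) ℝ) (f : Fin N → V),
        ∑ l, W (j + t) i l • ∑ p, A l p • f p = ∑ p, (W (j + t) * A) i p • f p := by
      intro A f
      simp only [Matrix.mul_apply, Finset.smul_sum, Finset.sum_smul, smul_smul]
      exact Finset.sum_comm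
    rw [hv, Finset.sum_range_succ]
    simp only [ih, smul_add, Finset.sum_add_distrib]
    rw [hmul, transition, add_assoc]
    congr 1
    congr 1
    · simp only [Finset.smul_sum (s := Finset.range t)]
      rw [Finset.sum_comm]
      refine Finset.sum_congr rfl fun r hr => ?_
      rw [Finset.mem_range] at hr
      rw [hmul, show t + 1 - 1 - r = (t - 1 - r) + 1 by omega, transition,
        show j + r + 1 + (t - 1 - r) = j + t by omega]
    · simp [transition, Matrix.one_apply]

/-- Dynamic average tracking: the disagreement decays geometrically up to the inputs. -/
theorem norm_sub_mean_le {C ρ : ℝ} (hcol : ∀ k l, ∑ i, W k i l = 1)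
    (hC : ∀ j t i l, |transition W j t i l - 1 / (N : ℝ)| ≤ C * ρ ^ t)
    {V : Type*} [NormedAddCommGroup V] [NormedSpace ℝ V] {j : ℕ} {v u : ℕ → Fin N → V}
    (hv : ∀ t i, v (t + 1) i = ∑ l, W (j + t) i l • v t l + u t i) (t : ℕ) (i : Fin N) :
    ‖v t i - (1 / (N : ℝ)) • ∑ l, v t l‖
      ≤ C * (ρ ^ t * ∑ l, ‖v 0 l‖ + geomConv ρ (fun r => ∑ l, ‖u r l‖) t) := by
  have hmean : ∑ l, v t l = ∑ l, v 0 l + ∑ r ∈ Finset.range t, ∑ l, u r l := by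
    induction t with
    | zero => simp
    | succ t ih =>
      rw [Finset.sum_range_succ, ← add_assoc, ← ih]
      simp only [hv, Finset.sum_add_distrib]
      rw [Finset.sum_comm]
      simp only [← Finset.sum_smul, hcol, one_smul]
  have e1 : v t i - (1 / (N : ℝ)) • ∑ l, v t l
      = ∑ l, (transition W j t i l - 1 / (N : ℝ)) • v 0 l + ∑ r ∈ Finset.range t,
        ∑ l, (transition W (j + r + 1) (t - 1 - r) i l - 1 / (N : ℝ)) • u r l := by
    rw [hmean, solution_eq_transition hv t i]
    simp only [sub_smul, Finset.sum_sub_distrib, smul_add, Finset.smul_sum]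
    abel
  have hb : ∀ (j t : ℕ) (f : Fin N → V),
      ‖∑ l, (transition W j t i l - 1 / (N : ℝ)) • f l‖ ≤ C * ρ ^ t * ∑ l, ‖f l‖ := by
    intro j t f
    rw [Finset.mul_sum]
    refine (norm_sum_le _ _).trans (Finset.sum_le_sum fun l _ => ?_)
    rw [norm_smul, Real.norm_eq_abs]
    exact mul_le_mul_of_nonneg_right (hC _ _ _ _) (norm_nonneg _)
  rw [e1, mul_add, ← mul_assoc]
  refine (norm_add_le _ _).trans (add_le_add (hb _ _ _) ?_)
  rw [geomConv, Finset.mul_sum]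
  refine (norm_sum_le _ _).trans (Finset.sum_le_sum fun r _ => (hb _ _ _).trans ?_)
  rw [mul_assoc]

end Transition

/-! ### Weights of past points in the tracking variables. -/

/-- The fraction of an initial value that survives relaxation steps `j, …, j + t - 1`. -/
def retain (γ : ℕ → ℝ) (j t : ℕ) : ℝ := ∏ r ∈ Finset.range t, (1 - γ (j + r))

/-- The response of the tracking variables at time `j + t` to unit values entering at time `j` and
fading out by relaxation. -/
def response {N : ℕ} (W : ℕ → Matrix (Fin N) (Fin N) ℝ) (γ : ℕ → ℝ) (j : ℕ) :
    ℕ → Matrix (Fin N) (Fin N) ℝ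
  | 0 => 1
  | t + 1 => W (j + t) * response W γ j t - (γ (j + t) * retain γ j t) • 1

section Retain

variable {γ : ℕ → ℝ}

theorem retain_zero (j : ℕ) : retain γ j 0 = 1 := by simp [retain]

theorem retain_succ (j t : ℕ) : retain γ j (t + 1) = retain γ j t * (1 - γ (j + t)) := by
  rw [retain, Finset.prod_range_succ, retain]

theorem retain_add (j s t : ℕ) : retain γ j (s + t) = retain γ j s * retain γ (j + s) t := by
  induction t with
  | zero => simp [retain_zero]
  | succ t ih => rw [← add_assoc, retain_succ, ih, retain_succ, ← add_assoc, mul_assoc]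

theorem retain_nonneg (h1 : ∀ k, γ k ≤ 1) (j t : ℕ) : 0 ≤ retain γ j t :=
  Finset.prod_nonneg fun _ _ => sub_nonneg.2 (h1 _)

theorem retain_le_one (h0 : ∀ k, 0 ≤ γ k) (h1 : ∀ k, γ k ≤ 1) (j t : ℕ) : retain γ j t ≤ 1 :=
  Finset.prod_le_one (fun _ _ => sub_nonneg.2 (h1 _)) fun r _ => by linarith [h0 (j + r)]

/-- For vanishing relaxation, `retain` decays slower than any prescribed geometric sequence. -/
theorem exists_mul_pow_le_retain (hanti : Antitone γ) (hγ0 : 0 ≤ γ 0) (hγ1 : γ 0 < 1)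
    (hlim : Tendsto γ atTop (𝓝 0)) {q : ℝ} (hq0 : 0 < q) (hq1 : q < 1) :
    ∃ c, 0 < c ∧ ∀ j t, c * q ^ t ≤ retain γ j t := by
  obtain ⟨K, hK⟩ := eventually_atTop.1 (hlim.eventually_lt_const (sub_pos.2 hq1))
  have hp : 0 < 1 - γ 0 := sub_pos.2 hγ1
  have hp1 : 1 - γ 0 ≤ 1 := by linarith
  -- At most `K` factors have index below `K`; those are at least `1 - γ 0`, all others at least
  -- `q`.
  have key : ∀ j t, (1 - γ 0) ^ (min t K) * q ^ t ≤ retain γ j t := by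
    intro j t
    induction t with
    | zero => simp [retain_zero]
    | succ t ih =>
      rw [retain_succ]
      have hnn : 0 ≤ (1 - γ 0) ^ (min t K) * q ^ t := by positivity
      have hf0 : 1 - γ 0 ≤ 1 - γ (j + t) := by linarith [hanti (Nat.zero_le (j + t))]
      by_cases h : K ≤ j + t
      · have h2 : q ≤ 1 - γ (j + t) := by linarith [hK _ h]
        calc (1 - γ 0) ^ (min (t + 1) K) * q ^ (t + 1)
            ≤ (1 - γ 0) ^ (min t K) * q ^ t * q := by
              rw [pow_succ, ← mul_assoc]
              gcongr ?_ * _ * _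
              exact pow_le_pow_of_le_one hp.le hp1 (by omega)
          _ ≤ _ := mul_le_mul ih h2 hq0.le (hnn.trans ih)
      · rw [show min (t + 1) K = min t K + 1 by omega]
        calc (1 - γ 0) ^ (min t K + 1) * q ^ (t + 1)
            = ((1 - γ 0) ^ (min t K) * q ^ t) * ((1 - γ 0) * q) := by ring
          _ ≤ ((1 - γ 0) ^ (min t K) * q ^ t) * ((1 - γ 0) * 1) := by gcongr
          _ ≤ _ := by
            rw [mul_one]
            exact mul_le_mul ih hf0 hp.le (hnn.trans ih)
  refine ⟨(1 - γ 0) ^ K, by positivity, fun j t => le_trans ?_ (key j t)⟩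
  gcongr ?_ * _
  exact pow_le_pow_of_le_one hp.le hp1 (min_le_right _ _)

end Retain

section Response

variable {N : ℕ} {W : ℕ → Matrix (Fin N) (Fin N) ℝ} {γ : ℕ → ℝ}

theorem response_succ_apply (j t : ℕ) (i l : Fin N) :
    response W γ j (t + 1) i l = ∑ p, W (j + t) i p * response W γ j t p l
      - γ (j + t) * retain γ j t * (1 : Matrix (Fin N) (Fin N) ℝ) i l := by
  simp [response, Matrix.mul_apply]

theorem response_col (hcol : ∀ k l, ∑ i, W k i l = 1) (j t : ℕ) (l : Fin N) :
    ∑ i, response W γ j t i l = retain γ j t := by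
  induction t with
  | zero => simp [response, Matrix.one_apply, retain_zero]
  | succ t ih =>
    simp only [response_succ_apply, Finset.sum_sub_distrib]
    rw [Finset.sum_comm, retain_succ]
    simp only [← Finset.sum_mul, hcol, one_mul, ih, ← Finset.mul_sum]
    simp [Matrix.one_apply]
    ring

/-- Each column of `response` is itself a tracking system, with inputs `-γ * retain` at a single
agent and column sum `retain`, so `norm_sub_mean_le` applies. -/
theorem abs_response_sub_le {C ρ : ℝ} (hcol : ∀ k l, ∑ i, W k i l = 1)
    (hC : ∀ j t i l, |transition W j t i l - 1 / (N : ℝ)| ≤ C * ρ ^ t)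
    (h0 : ∀ k, 0 ≤ γ k) (h1 : ∀ k, γ k ≤ 1) (j t : ℕ) (i l : Fin N) :
    |response W γ j t i l - retain γ j t / N|
      ≤ C * (ρ ^ t + geomConv ρ (fun r => γ (j + r) * retain γ j r) t) := by
  have h := norm_sub_mean_le hcol hC (j := j) (v := fun t i => response W γ j t i l)
    (u := fun t i => -(γ (j + t) * retain γ j t * (1 : Matrix (Fin N) (Fin N) ℝ) i l))
    (fun t i => by simp [response_succ_apply, sub_eq_add_neg]) t i
  have hu : ∀ r, ∑ i, ‖-(γ (j + r) * retain γ j r * (1 : Matrix (Fin N) (Fin N) ℝ) i l)‖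
      = γ (j + r) * retain γ j r := by
    intro r
    have hnn := mul_nonneg (h0 (j + r)) (retain_nonneg h1 j r)
    simp only [norm_neg, norm_mul (γ (j + r) * retain γ j r), ← Finset.mul_sum,
      Real.norm_of_nonneg hnn]
    simp [Matrix.one_apply, apply_ite]
  have hv : ∑ i, ‖response W γ j 0 i l‖ = 1 := by
    simp [response, Matrix.one_apply, apply_ite]
  simp only [hu, hv, response_col hcol, smul_eq_mul, mul_one] at h
  rwa [one_div, inv_mul_eq_div, Real.norm_eq_abs] at h

/-- The subtraction hits only the diagonal and takes at most `γ j` per step, while the self-weights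
preserve mass `ε ^ t` there. This covers short delays after a late start. -/
theorem response_nonneg_of_small {ε : ℝ} (hε : 0 < ε) (hε1 : ε ≤ 1)
    (hW : ∀ k i l, 0 ≤ W k i l) (hdiag : ∀ k i, ε ≤ W k i i) (hanti : Antitone γ)
    (h0 : ∀ k, 0 ≤ γ k) (h1 : ∀ k, γ k ≤ 1) {j T : ℕ} (hj : T * γ j ≤ ε ^ T) {t : ℕ} (ht : t ≤ T)
    (l : Fin N) :
    (∀ i, 0 ≤ response W γ j t i l) ∧ ε ^ t - t * γ j ≤ response W γ j t l l := by
  induction t with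
  | zero =>
    refine ⟨fun i => ?_, by simp [response]⟩
    rw [response, Matrix.one_apply]
    split_ifs <;> norm_num
  | succ t ih =>
    obtain ⟨ih1, ih2⟩ := ih (by omega)
    have hterm : ∀ i p, 0 ≤ W (j + t) i p * response W γ j t p l := fun i p =>
      mul_nonneg (hW _ _ _) (ih1 p)
    have hd : ε ^ (t + 1) - ((t + 1 : ℕ) : ℝ) * γ j ≤ response W γ j (t + 1) l l := by
      rw [response_succ_apply, Matrix.one_apply_eq, mul_one]
      have a1 : W (j + t) l l * response W γ j t l l
          ≤ ∑ p, W (j + t) l p * response W γ j t p l :=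
        Finset.single_le_sum (f := fun p => W (j + t) l p * response W γ j t p l)
          (fun p _ => hterm l p) (Finset.mem_univ l)
      have a2 : ε * response W γ j t l l ≤ W (j + t) l l * response W γ j t l l :=
        mul_le_mul_of_nonneg_right (hdiag _ _) (ih1 l)
      have a3 := mul_le_mul_of_nonneg_left ih2 hε.le
      have a4 : γ (j + t) * retain γ j t ≤ γ j := by
        have b1 := mul_le_mul_of_nonneg_left (retain_le_one h0 h1 j t) (h0 (j + t))
        linarith [hanti (Nat.le_add_right j t)]
      have a5 : ε * ((t : ℝ) * γ j) ≤ 1 * ((t : ℝ) * γ j) :=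
        mul_le_mul_of_nonneg_right hε1 (mul_nonneg (Nat.cast_nonneg _) (h0 j))
      rw [pow_succ']
      push_cast
      linarith
    refine ⟨fun i => ?_, hd⟩
    by_cases hil : i = l
    · subst hil
      refine le_trans ?_ hd
      have a1 : ε ^ T ≤ ε ^ (t + 1) := pow_le_pow_of_le_one hε.le hε1 ht
      have a2 : ((t + 1 : ℕ) : ℝ) * γ j ≤ T * γ j :=
        mul_le_mul_of_nonneg_right (by exact_mod_cast ht) (h0 j)
      linarith
    · rw [response_succ_apply, Matrix.one_apply_ne hil, mul_zero, sub_zero]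
      exact Finset.sum_nonneg fun p _ => hterm i p

/-- For long delays, `response` is close to `retain / N`. The error beats `retain` because mixing
has rate `ρ`, whereas `retain` decays slower than `q ^ t` for a chosen `q` in `(ρ, 1)`. This needs
`γ 0 < 1`: a factor `1 - γ = 0` would kill `retain` and leave weights of both signs. -/
theorem exists_response_nonneg [NeZero N] {C ρ ε : ℝ} (hC0 : 0 < C) (hρ0 : 0 < ρ) (hρ1 : ρ < 1)
    (hε : 0 < ε) (hε1 : ε ≤ 1) (hW : ∀ k i l, 0 ≤ W k i l) (hdiag : ∀ k i, ε ≤ W k i i)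
    (hcol : ∀ k l, ∑ i, W k i l = 1)
    (hC : ∀ j t i l, |transition W j t i l - 1 / (N : ℝ)| ≤ C * ρ ^ t)
    (hanti : Antitone γ) (h0 : ∀ k, 0 ≤ γ k) (h1 : ∀ k, γ k ≤ 1) (hγ1 : γ 0 < 1)
    (hlim : Tendsto γ atTop (𝓝 0)) :
    ∃ K, ∀ j t, K ≤ j + t → ∀ i l, 0 ≤ response W γ j t i l := by
  have hN0 : (0 : ℝ) < N := by exact_mod_cast Nat.pos_of_ne_zero (NeZero.ne N)
  obtain ⟨q, hq, hq1⟩ := exists_between hρ1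
  have hq0 : 0 < q := hρ0.trans hq
  obtain ⟨c, hc, hret⟩ := exists_mul_pow_le_retain hanti (h0 0) hγ1 hlim hq0 hq1
  set ρ' := ρ / q with hρ'
  have hρ'0 : 0 < ρ' := by positivity
  have hρ'1 : ρ' < 1 := (div_lt_one hq0).2 hq
  have hpow : ∀ s, ρ ^ s = ρ' ^ s * q ^ s := fun s => by
    rw [hρ', div_pow, div_mul_cancel₀ _ (by positivity)]
  have hmain : ∀ j t i l, retain γ j t * (1 / N - C / c * (ρ' ^ t + geomConv ρ' γ (j + t) / q))
      ≤ response W γ j t i l := by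
    intro j t i l
    have a1 := (abs_le.1 (abs_response_sub_le hcol hC h0 h1 j t i l)).1
    have a2 : ρ ^ t ≤ retain γ j t * (ρ' ^ t / c) := by
      rw [hpow, mul_div_assoc', le_div_iff₀ hc]
      nlinarith [hret j t, pow_pos hρ'0 t]
    have a3 : geomConv ρ (fun r => γ (j + r) * retain γ j r) t
        ≤ retain γ j t * (geomConv ρ' (fun r => γ (j + r)) t / (c * q)) := by
      rw [geomConv, geomConv, Finset.sum_div, Finset.mul_sum]
      refine Finset.sum_le_sum fun r hr => ?_
      rw [Finset.mem_range] at hr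
      obtain ⟨s, rfl⟩ : ∃ s, t = r + (s + 1) := ⟨t - 1 - r, by omega⟩
      rw [retain_add, show r + (s + 1) - 1 - r = s by omega, hpow]
      have b1 := hret (j + r) (s + 1)
      rw [mul_div_assoc', le_div_iff₀ (by positivity)]
      have b2 : 0 ≤ ρ' ^ s * (γ (j + r) * retain γ j r) :=
        mul_nonneg (by positivity) (mul_nonneg (h0 _) (retain_nonneg h1 _ _))
      calc ρ' ^ s * q ^ s * (γ (j + r) * retain γ j r) * (c * q)
          = ρ' ^ s * (γ (j + r) * retain γ j r) * (c * q ^ (s + 1)) := by ring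
        _ ≤ ρ' ^ s * (γ (j + r) * retain γ j r) * retain γ (j + r) (s + 1) := by gcongr
        _ = _ := by ring
    have a4 := geomConv_shift_le hρ'0.le h0 j t
    have a5 : retain γ j t * (geomConv ρ' (fun r => γ (j + r)) t / (c * q))
        ≤ retain γ j t * (geomConv ρ' γ (j + t) / (c * q)) := by
      have := retain_nonneg h1 j t
      gcongr
    have a6 : C * (ρ ^ t + geomConv ρ (fun r => γ (j + r) * retain γ j r) t)
        ≤ C * (retain γ j t * (ρ' ^ t / c) + retain γ j t * (geomConv ρ' γ (j + t) / (c * q))) := by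
      gcongr
      exact a3.trans a5
    have a7 : retain γ j t * (1 / N - C / c * (ρ' ^ t + geomConv ρ' γ (j + t) / q))
        = retain γ j t / N - C * (retain γ j t * (ρ' ^ t / c)
          + retain γ j t * (geomConv ρ' γ (j + t) / (c * q))) := by
      field_simp
    rw [a7]
    linarith
  have hbar : 0 < 1 / (2 * (N : ℝ)) := by positivity
  have l1 : Tendsto (fun t => C / c * ρ' ^ t) atTop (𝓝 0) := by
    simpa using (tendsto_pow_atTop_nhds_zero_of_lt_one hρ'0.le hρ'1).const_mul (C / c)
  have l2 : Tendsto (fun k => C / c * (geomConv ρ' γ k / q)) atTop (𝓝 0) := by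
    simpa using ((tendsto_geomConv hρ'0.le hρ'1 h0 hlim).div_const q).const_mul (C / c)
  obtain ⟨T, hT⟩ := eventually_atTop.1 (l1.eventually_lt_const hbar)
  obtain ⟨K, hK⟩ := eventually_atTop.1 (l2.eventually_lt_const hbar)
  have l3 : Tendsto (fun k => (T : ℝ) * γ k) atTop (𝓝 0) := by
    simpa using hlim.const_mul (T : ℝ)
  obtain ⟨J, hJ⟩ := eventually_atTop.1 (l3.eventually_lt_const (pow_pos hε T))
  -- If the delay `t` is at most `T`, then `J + T ≤ j + t` forces a late start `J ≤ j`.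
  refine ⟨max K (J + T), fun j t hjt i l => ?_⟩
  rcases le_total T t with h | h
  · refine le_trans (mul_nonneg (retain_nonneg h1 _ _) ?_) (hmain j t i l)
    have b1 := hT t h
    have b2 := hK (j + t) (le_trans (le_max_left _ _) hjt)
    have b3 : 1 / (N : ℝ) = 1 / (2 * (N : ℝ)) + 1 / (2 * (N : ℝ)) := by field_simp; norm_num
    rw [mul_add]
    linarith
  · have hj : J ≤ j := by
      have := (le_max_right K (J + T)).trans hjt
      omega
    exact (response_nonneg_of_small hε hε1 hW hdiag hanti h0 h1 (hJ j hj).le h l).1 i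

/-- By linearity, the target `b r` enters at time `r + 1` with weight `γ r` and is relaxed away
afterwards. `retain` records what is left of it in `a`, and `response` its share in `s`. -/
theorem tracking_eq_response {a b s : ℕ → Fin N → ℝ}
    (ha : ∀ k i, a (k + 1) i = a k i + γ k * (b k i - a k i))
    (hs : ∀ k i, s (k + 1) i = ∑ l, W k i l * s k l + (a (k + 1) i - a k i))
    (hs0 : s 0 = a 0) (k : ℕ) :
    (∀ i, a k i = retain γ 0 k * a 0 i
      + ∑ r ∈ Finset.range k, γ r * (retain γ (r + 1) (k - 1 - r) * b r i)) ∧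
    ∀ i, s k i = ∑ l, response W γ 0 k i l * a 0 l
      + ∑ r ∈ Finset.range k, γ r * ∑ l, response W γ (r + 1) (k - 1 - r) i l * b r l := by
  have hresp : ∀ (j t : ℕ) (f : Fin N → ℝ) (i : Fin N),
      ∑ l, response W γ j (t + 1) i l * f l
        = ∑ p, W (j + t) i p * ∑ l, response W γ j t p l * f l
          - γ (j + t) * (retain γ j t * f i) := by
    intro j t f i
    simp only [response_succ_apply, sub_mul, Finset.sum_sub_distrib, Finset.sum_mul,
      Finset.mul_sum]
    rw [Finset.sum_comm]
    congr 1
    · simp only [mul_assoc]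
    · simp [Matrix.one_apply]
      ring
  induction k with
  | zero => simp [retain_zero, response, Matrix.one_apply, hs0]
  | succ k ih =>
    obtain ⟨ih1, ih2⟩ := ih
    constructor
    · intro i
      rw [ha, Finset.sum_range_succ, retain_succ, show k + 1 - 1 - k = 0 by omega, retain_zero]
      have e1 : ∑ r ∈ Finset.range k, γ r * (retain γ (r + 1) (k + 1 - 1 - r) * b r i)
          = (1 - γ k) * ∑ r ∈ Finset.range k, γ r * (retain γ (r + 1) (k - 1 - r) * b r i) := by
        rw [Finset.mul_sum]
        refine Finset.sum_congr rfl fun r hr => ?_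
        rw [Finset.mem_range] at hr
        rw [show k + 1 - 1 - r = (k - 1 - r) + 1 by omega, retain_succ,
          show r + 1 + (k - 1 - r) = k by omega]
        ring
      rw [e1, ih1, zero_add]
      ring
    · intro i
      rw [hs, ha, Finset.sum_range_succ, hresp, show k + 1 - 1 - k = 0 by omega, zero_add]
      have e1 : ∑ r ∈ Finset.range k,
            γ r * ∑ l, response W γ (r + 1) (k + 1 - 1 - r) i l * b r l
          = ∑ p, W k i p * (∑ r ∈ Finset.range k,
              γ r * ∑ l, response W γ (r + 1) (k - 1 - r) p l * b r l)
            - γ k * ∑ r ∈ Finset.range k, γ r * (retain γ (r + 1) (k - 1 - r) * b r i) := by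
        simp only [Finset.mul_sum (Finset.range k)]
        rw [Finset.sum_comm, ← Finset.sum_sub_distrib]
        refine Finset.sum_congr rfl fun r hr => ?_
        rw [Finset.mem_range] at hr
        rw [show k + 1 - 1 - r = (k - 1 - r) + 1 by omega, hresp,
          show r + 1 + (k - 1 - r) = k by omega, mul_sub, Finset.mul_sum]
        congr 1
        · exact Finset.sum_congr rfl fun p _ => by ring
        · ring
      rw [e1, ih1]
      simp only [ih2, mul_add, Finset.sum_add_distrib, response, Matrix.one_apply]
      simp
      ring

/-- If the relaxations start below `1`, the tracking variables eventually stay in every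
convex set that contains the tracked points and their targets. -/
theorem tracking_mem_of_response_nonneg {V : Type*} [NormedAddCommGroup V] [NormedSpace ℝ V]
    {H : Set V} (hconv : Convex ℝ H) (hrow : ∀ k i, ∑ l, W k i l = 1)
    (h0 : ∀ k, 0 ≤ γ k) {K : ℕ} (hK : ∀ j t, K ≤ j + t → ∀ i l, 0 ≤ response W γ j t i l)
    {x xt s : ℕ → Fin N → V} (hx : ∀ k i, x (k + 1) i = x k i + γ k • (xt k i - x k i))
    (hs : ∀ k i, s (k + 1) i = ∑ l, W k i l • s k l + (x (k + 1) i - x k i))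
    (hs0 : s 0 = x 0) (hx0 : ∀ i, x 0 i ∈ H) (hxt : ∀ k i, xt k i ∈ H) {k : ℕ} (hk : K ≤ k)
    (i : Fin N) : s k i ∈ H := by
  -- `H` need not be closed, but the hull of the finitely many points used up to time `k` is, so
  -- strict separation is available.
  let P : Set V := Set.range (x 0) ∪ ⋃ r ∈ Finset.range k, Set.range (xt r)
  have hPfin : P.Finite := (Set.finite_range _).union
    ((Finset.range k).finite_toSet.biUnion fun r _ => Set.finite_range _)
  have hPH : convexHull ℝ P ⊆ H := by
    refine convexHull_min ?_ hconv
    rintro _ (⟨l, rfl⟩ | hp)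
    · exact hx0 l
    · obtain ⟨r, -, l, rfl⟩ := Set.mem_iUnion₂.1 hp
      exact hxt r l
  by_contra hmem
  obtain ⟨f, u, hfu, hu⟩ := geometric_hahn_banach_closed_point (convex_convexHull ℝ P)
    (hPfin.isClosed_convexHull ℝ) fun hp => hmem (hPH hp)
  have hf0 : ∀ l, f (x 0 l) < u := fun l => hfu _ (subset_convexHull ℝ P (Or.inl ⟨l, rfl⟩))
  have hft : ∀ r ∈ Finset.range k, ∀ l, f (xt r l) < u := fun r hr l =>
    hfu _ (subset_convexHull ℝ P (Or.inr (Set.mem_iUnion₂.2 ⟨r, hr, l, rfl⟩)))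
  -- The slack `u - f` of the separating functional obeys the same recursions, because rows of `W`
  -- sum to `1`. Nonnegative responses keep it nonnegative at `s k i`, a contradiction.
  have h := (tracking_eq_response (W := W) (γ := γ) (a := fun k i => u - f (x k i))
    (b := fun k i => u - f (xt k i)) (s := fun k i => u - f (s k i)) ?_ ?_ ?_ k).2 i
  · have hnn : 0 ≤ u - f (s k i) := by
      rw [h]
      refine add_nonneg (Finset.sum_nonneg fun l _ => mul_nonneg (hK _ _ (by omega) _ _)
        (sub_nonneg.2 (hf0 l).le)) (Finset.sum_nonneg fun r hr => mul_nonneg (h0 r)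
        (Finset.sum_nonneg fun l _ => mul_nonneg (hK _ _ ?_ _ _)
          (sub_nonneg.2 (hft r hr l).le)))
      rw [Finset.mem_range] at hr
      omega
    linarith
  · intro k i
    simp only [hx, map_add, map_smul, map_sub, smul_eq_mul]
    ring
  · intro k i
    simp only [hs, map_add, map_sub, map_sum, map_smul, smul_eq_mul, mul_sub,
      Finset.sum_sub_distrib, ← Finset.sum_mul, hrow]
    ring
  · rw [hs0]

end Response

/-! ### Projections, stacked vectors, gradient inequality. -/

section Projection

variable {d : ℕ} {S : Set (Vec d)}

theorem proj_spec (hcl : IsClosed S) (hne : S.Nonempty) (x : Vec d) :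
    proj S x ∈ S ∧ ∀ z ∈ S, ‖proj S x - x‖ ≤ ‖z - x‖ := by
  refine Classical.epsilon_spec (p := fun y => y ∈ S ∧ ∀ z ∈ S, ‖y - x‖ ≤ ‖z - x‖) ?_
  obtain ⟨y, hy, hxy⟩ := hcl.exists_infDist_eq_dist hne x
  refine ⟨y, hy, fun z hz => ?_⟩
  rw [← dist_eq_norm, ← dist_eq_norm, dist_comm y, dist_comm z, ← hxy]
  exact Metric.infDist_le_dist_of_mem hz

theorem proj_mem (hcl : IsClosed S) (hne : S.Nonempty) (x : Vec d) : proj S x ∈ S :=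
  (proj_spec hcl hne x).1

theorem inner_sub_proj_le (hcl : IsClosed S) (hconv : Convex ℝ S) {x z : Vec d} (hz : z ∈ S) :
    inner ℝ (x - proj S x) (z - proj S x) ≤ 0 := by
  obtain ⟨hp, hmin⟩ := proj_spec hcl ⟨z, hz⟩ x
  refine (norm_eq_iInf_iff_real_inner_le_zero hconv hp).1 (le_antisymm ?_ ?_) z hz
  · have : Nonempty S := ⟨⟨z, hz⟩⟩
    refine le_ciInf fun w => ?_
    rw [norm_sub_rev, norm_sub_rev x]
    exact hmin w w.2
  · exact ciInf_le ⟨0, by rintro _ ⟨w, rfl⟩; exact norm_nonneg _⟩ (⟨proj S x, hp⟩ : S)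

theorem norm_proj_sub_proj_le (hcl : IsClosed S) (hconv : Convex ℝ S) (hne : S.Nonempty)
    (x y : Vec d) : ‖proj S x - proj S y‖ ≤ ‖x - y‖ := by
  have h1 := inner_sub_proj_le hcl hconv (x := x) (proj_mem hcl hne y)
  have h2 := inner_sub_proj_le hcl hconv (x := y) (proj_mem hcl hne x)
  have h3 : ‖proj S x - proj S y‖ ^ 2 ≤ inner ℝ (x - y) (proj S x - proj S y) := by
    rw [← real_inner_self_eq_norm_sq]
    simp only [inner_sub_left, inner_sub_right] at h1 h2 ⊢
    linarith
  have h4 := h3.trans (real_inner_le_norm _ _)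
  rcases (norm_nonneg (proj S x - proj S y)).eq_or_lt with h | h
  · rw [← h]; positivity
  · nlinarith

end Projection

theorem isClosed_orthant (m : ℕ) : IsClosed (orthant m) := by
  have : orthant m = ⋂ k, {v : Vec m | 0 ≤ v k} := by ext v; simp [orthant]
  rw [this]
  exact isClosed_iInter fun k => isClosed_le continuous_const (by fun_prop)

theorem convex_orthant (m : ℕ) : Convex ℝ (orthant m) := by
  intro v hv w hw a b ha hb _ k
  simpa using add_nonneg (mul_nonneg ha (hv k)) (mul_nonneg hb (hw k))

theorem zero_mem_orthant (m : ℕ) : (0 : Vec m) ∈ orthant m := fun k => by simp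

section Stacks

variable {N d : ℕ}

@[simp] theorem col_apply (f : Fin N → Vec d) (i : Fin N) : col f i = f i := rfl

theorem stack_inner (x y : Stack N d) : inner ℝ x y = ∑ i, inner ℝ (x i) (y i) :=
  PiLp.inner_apply x y

theorem isClosed_prodSet {S : Fin N → Set (Vec d)} (hS : ∀ i, IsClosed (S i)) :
    IsClosed (prodSet S) := by
  have : prodSet S = ⋂ i, (fun x : Stack N d => x i) ⁻¹' S i := by ext v; simp [prodSet]
  rw [this]
  exact isClosed_iInter fun i => (hS i).preimage (by fun_prop)

theorem convex_prodSet {S : Fin N → Set (Vec d)} (hS : ∀ i, Convex ℝ (S i)) :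
    Convex ℝ (prodSet S) := fun _ hv _ hw _ _ ha hb hab i => hS i (hv i) (hw i) ha hb hab

theorem norm_le_sum_norm (x : Stack N d) : ‖x‖ ≤ ∑ i, ‖x i‖ := by
  rw [PiLp.norm_eq_of_L2, Real.sqrt_le_left (Finset.sum_nonneg fun i _ => norm_nonneg _)]
  exact Finset.sum_sq_le_sq_sum_of_nonneg fun i _ => norm_nonneg _

theorem norm_block_le (x : Stack N d) (i : Fin N) : ‖x i‖ ≤ ‖x‖ := PiLp.norm_apply_le x i

theorem deviate_mem {S : Fin N → Set (Vec d)} {x : Stack N d} (hx : x ∈ prodSet S) {i : Fin N}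
    {z : Vec d} (hz : z ∈ S i) :
    (col (Function.update (fun j => x j) i z) : Stack N d) ∈ prodSet S := by
  intro j
  by_cases hj : j = i
  · subst hj; simpa using hz
  · simpa [hj] using hx j

theorem normalCone_block {S : Fin N → Set (Vec d)} {x a : Stack N d}
    (ha : a ∈ normalCone (prodSet S) x) (i : Fin N) : a i ∈ normalCone (S i) (x i) := by
  refine ⟨ha.1 i, fun z hz => ?_⟩
  have h := ha.2 _ (deviate_mem ha.1 hz)
  rw [stack_inner, Finset.sum_eq_single i] at h
  · simpa using h
  · intro j _ hj
    simp [hj]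
  · simp

end Stacks

theorem ConvexOn.add_inner_gradient_le {E : Type*} [NormedAddCommGroup E] [InnerProductSpace ℝ E]
    [CompleteSpace E] {S : Set E} {f : E → ℝ} (hf : ConvexOn ℝ S f) {x z : E} (hx : x ∈ S)
    (hz : z ∈ S) (hd : DifferentiableAt ℝ f x) : f x + inner ℝ (gradient f x) (z - x) ≤ f z := by
  have h1 : HasDerivAt (fun t : ℝ => x + t • (z - x)) (z - x) 0 := by
    simpa using ((hasDerivAt_id (0 : ℝ)).smul_const (z - x)).const_add x
  have h2 : HasFDerivAt f (fderiv ℝ f x) (x + (0 : ℝ) • (z - x)) := by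
    simpa using hd.hasFDerivAt
  have h3 := h2.comp_hasDerivAt (0 : ℝ) h1
  have h4 := h3.tendsto_slope_zero_right
  have h5 : inner ℝ (gradient f x) (z - x) = fderiv ℝ f x (z - x) := by
    rw [gradient, InnerProductSpace.toDual_symm_apply]
  have h6 : fderiv ℝ f x (z - x) ≤ f z - f x := by
    refine le_of_tendsto h4 ?_
    filter_upwards [Ioc_mem_nhdsGT (zero_lt_one' ℝ)] with t ht
    have h7 := hf.2 hx hz (sub_nonneg.2 ht.2) ht.1.le (sub_add_cancel 1 t)
    have h8 : (1 - t) • x + t • z = x + t • (z - x) := by module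
    rw [h8] at h7
    simp only [Function.comp_apply, zero_add, zero_smul, add_zero, smul_eq_mul] at h7 ⊢
    rw [inv_mul_eq_div, div_le_iff₀ ht.1]
    linarith
  linarith

/-! ### From zeros of `T` to variational equilibria. -/

namespace AggGame

variable {N n m : ℕ} {g : AggGame N n m}

theorem avg_eq_add_others (x : Stack N n) (i : Fin N) :
    avg x = (1 / (N : ℝ)) • x i + others i x := by
  rw [avg, others, ← smul_add, Finset.add_sum_erase _ _ (Finset.mem_univ i)]

theorem avg_mem_hull [NeZero N] {x : Stack N n} (hx : x ∈ prodSet g.Ω) : avg x ∈ g.hull := by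
  rw [avg, Finset.smul_sum]
  refine (convex_convexHull ℝ _).sum_mem (fun i _ => by positivity) ?_ fun i _ =>
    subset_convexHull ℝ _ (Set.mem_iUnion.2 ⟨i, hx i⟩)
  have : (N : ℝ) ≠ 0 := by exact_mod_cast NeZero.ne N
  simp [this]

/-- Chain rule along `z ↦ (z, z / N + u)`. -/
theorem gradient_ownCost {i : Fin N} {v w u : Vec n} (hw : w = (1 / (N : ℝ)) • v + u)
    (hd : DifferentiableAt ℝ (fun p : Vec n × Vec n => g.J i p.1 p.2) (v, w)) :
    gradient (g.ownCost i u) v = g.partialGrad i v w := by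
  obtain ⟨D, hD⟩ := hd
  have h1 : HasFDerivAt (fun z => g.J i z w)
      (D.comp (ContinuousLinearMap.inl ℝ (Vec n) (Vec n))) v :=
    HasFDerivAt.comp (f := fun z => (z, w)) (g := fun p : Vec n × Vec n => g.J i p.1 p.2) v hD
      (hasFDerivAt_prodMk_left (𝕜 := ℝ) v w)
  have h2 : HasFDerivAt (fun z => g.J i v z)
      (D.comp (ContinuousLinearMap.inr ℝ (Vec n) (Vec n))) w :=
    hD.comp w (hasFDerivAt_prodMk_right v w)
  have h3 : HasFDerivAt (fun z : Vec n => (z, (1 / (N : ℝ)) • z + u))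
      ((ContinuousLinearMap.id ℝ (Vec n)).prod
        ((1 / (N : ℝ)) • ContinuousLinearMap.id ℝ (Vec n))) v :=
    (hasFDerivAt_id v).prodMk (((hasFDerivAt_id v).const_smul (1 / (N : ℝ))).add_const _)
  have h4 : HasFDerivAt (g.ownCost i u) (D.comp ((ContinuousLinearMap.id ℝ (Vec n)).prod
        ((1 / (N : ℝ)) • ContinuousLinearMap.id ℝ (Vec n)))) v := by
    rw [hw] at hD
    exact hD.comp v h3
  refine ext_inner_right ℝ fun z => ?_
  rw [partialGrad, gradient, gradient, gradient, h4.fderiv, h1.fderiv,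
    h2.fderiv, inner_add_left, real_inner_smul_left]
  simp only [InnerProductSpace.toDual_symm_apply]
  have : ((z, (1 / (N : ℝ)) • z) : Vec n × Vec n) = (z, 0) + (1 / (N : ℝ)) • (0, z) := by simp
  simp only [ContinuousLinearMap.comp_apply, ContinuousLinearMap.prod_apply,
    ContinuousLinearMap.inl_apply, ContinuousLinearMap.inr_apply]
  simp only [ContinuousLinearMap.id_apply, smul_apply]
  rw [this, map_add, map_smul, smul_eq_mul]

theorem pseudoGrad_apply [NeZero N] (hg : g.Standard) {x : Stack N n} (hx : x ∈ prodSet g.Ω)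
    (i : Fin N) : g.pseudoGrad x i = g.partialGrad i (x i) (avg x) :=
  gradient_ownCost (avg_eq_add_others x i) (hg.joint_diff i _ (hx i) _ (avg_mem_hull hx))

theorem isZeroT_of_variational {x : Stack N n} {l : Stack N m} (hx : x ∈ prodSet g.Ω)
    (hl : l ∈ prodSet fun _ : Fin N => orthant m)
    (h1 : ∀ z ∈ prodSet g.Ω, 0 ≤ inner ℝ (g.pseudoGrad x
      + (1 / (N : ℝ)) • col (fun i => (g.C i).adjoint (∑ j, l j))) (z - x))
    (h2 : ∀ z ∈ prodSet fun _ : Fin N => orthant m, 0 ≤ inner ℝ (col (fun i => l i - avg l)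
      - (1 / (N : ℝ)) • col (fun _ => g.coupling x)) (z - l)) : g.IsZeroT x l := by
  refine ⟨-(g.pseudoGrad x + (1 / (N : ℝ)) • col (fun i => (g.C i).adjoint (∑ j, l j))),
    ⟨hx, fun z hz => ?_⟩,
    -(col (fun i => l i - avg l) - (1 / (N : ℝ)) • col (fun _ => g.coupling x)),
    ⟨hl, fun z hz => ?_⟩, ?_, ?_⟩
  · rw [inner_neg_left]; linarith [h1 z hz]
  · rw [inner_neg_left]; linarith [h2 z hz]
  · simp only; abel
  · simp only; abel

theorem coupling_deviate (x : Stack N n) (i : Fin N) (z : Vec n) :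
    g.coupling (deviate i x z) = g.coupling x + g.C i (z - x i) := by
  rw [coupling, coupling, ← sub_eq_iff_eq_add', ← Finset.sum_sub_distrib, Finset.sum_eq_single i]
  · simp [deviate]
  · intro j _ hj
    simp [deviate, hj]
  · simp

/-- Test vectors alter coordinate `k` alone, to `0` and to `l k + 1`. -/
theorem nonpos_and_mul_eq_zero_of_mem_normalCone_orthant {b l : Vec m} (hb : b ∈ normalCone (orthant m) l)
    (k : Fin m) : b k ≤ 0 ∧ b k * l k = 0 := by
  have hl := hb.1
  have h1 : ∀ t : ℝ, 0 ≤ t → b k * (t - l k) ≤ 0 := by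
    intro t ht
    have h := hb.2 (WithLp.toLp 2 (Function.update (fun j => l j) k t)) fun j => by
      by_cases hj : j = k
      · subst hj; simpa using ht
      · simpa [hj] using hl j
    rw [PiLp.inner_apply, Finset.sum_eq_single k] at h
    · simpa [mul_comm] using h
    · intro j _ hj
      simp [hj]
    · simp
  have h2 := h1 0 le_rfl
  have h3 := h1 (l k + 1) (by linarith [hl k])
  have h4 : b k ≤ 0 := by linarith
  exact ⟨h4, le_antisymm (mul_nonpos_of_nonpos_of_nonneg h4 (hl k)) (by linarith)⟩

/-- Summing the dual inclusion over agents cancels the disagreement and gives feasibility. Where `l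
i k > 0`, complementarity gives `l i k - avg l k = coupling / N ≤ 0`; where it is `0` it is below
the average anyway. Deviations that are nonpositive and sum to zero vanish, so the multipliers
agree. -/
theorem isVariationalGNE_of_isZeroT [NeZero N] (hg : g.Standard) {x : Stack N n} {l : Stack N m}
    (h : g.IsZeroT x l) : g.IsVariationalGNE x := by
  have hN0 : (0 : ℝ) < N := by exact_mod_cast Nat.pos_of_ne_zero (NeZero.ne N)
  obtain ⟨a, ha, b, hb, h1, h2⟩ := h
  have hx : x ∈ prodSet g.Ω := ha.1
  have hl : ∀ i, l i ∈ orthant m := hb.1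
  have hbi : ∀ i, b i = (1 / (N : ℝ)) • g.coupling x - (l i - avg l) := by
    intro i
    have := congrArg (fun v : Stack N m => v i) h2
    simp only [PiLp.zero_apply, PiLp.sub_apply, PiLp.add_apply, PiLp.smul_apply, col_apply] at this
    rw [eq_sub_iff_add_eq, ← sub_eq_zero, this]
  have hsgn := fun i k => nonpos_and_mul_eq_zero_of_mem_normalCone_orthant (normalCone_block hb i) k
  have havg : ∀ k, avg l k = 1 / (N : ℝ) * ∑ i, l i k := fun k => by simp [avg]
  have hbk : ∀ i k, b i k = 1 / (N : ℝ) * g.coupling x k - (l i k - avg l k) := fun i k => by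
    rw [hbi]; simp
  have hsum : ∀ k, ∑ i, (l i k - avg l k) = 0 := by
    intro k
    rw [Finset.sum_sub_distrib, havg]
    simp only [Finset.sum_const, Finset.card_univ, Fintype.card_fin, nsmul_eq_mul]
    field_simp
    ring
  have hcoup : ∀ k, g.coupling x k ≤ 0 := by
    intro k
    have h3 : ∑ i, b i k = g.coupling x k := by
      simp only [hbk, Finset.sum_sub_distrib (f := fun _ => 1 / (N : ℝ) * g.coupling x k), hsum]
      simp only [Finset.sum_const, Finset.card_univ, Fintype.card_fin, nsmul_eq_mul]
      field_simp
      ring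
    rw [← h3]
    exact Finset.sum_nonpos fun i _ => (hsgn i k).1
  have hle : ∀ i k, l i k ≤ avg l k := by
    intro i k
    rcases (hl i k).eq_or_lt with h0 | h0
    · rw [← h0, havg]
      exact mul_nonneg (by positivity) (Finset.sum_nonneg fun j _ => hl j k)
    · have h3 := (mul_eq_zero.1 (hsgn i k).2).resolve_right h0.ne'
      have h4 : 1 / (N : ℝ) * g.coupling x k ≤ 0 :=
        mul_nonpos_of_nonneg_of_nonpos (by positivity) (hcoup k)
      linarith [hbk i k]
  have heq : ∀ i k, l i k = avg l k := by
    intro i k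
    have h3 := (Finset.sum_eq_zero_iff_of_nonpos
      (fun i _ => by linarith [hle i k])).1 (hsum k) i (Finset.mem_univ i)
    linarith
  have havgmem : avg l ∈ orthant m := fun k => by
    rw [← heq 0 k]; exact hl 0 k
  have hcompl : ∀ k, avg l k * g.coupling x k = 0 := by
    intro k
    have h3 := (hsgn 0 k).2
    rw [hbk, heq, sub_self, sub_zero] at h3
    have : (N : ℝ) * (1 / N * g.coupling x k * avg l k) = avg l k * g.coupling x k := by
      field_simp
    rw [← this, h3, mul_zero]
  have hinner : inner ℝ (avg l) (g.coupling x) = 0 := by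
    rw [PiLp.inner_apply]
    refine Finset.sum_eq_zero fun k _ => ?_
    simpa [mul_comm] using hcompl k
  have hstat : ∀ i, g.pseudoGrad x i + a i + (g.C i).adjoint (avg l) = 0 := by
    intro i
    have := congrArg (fun v : Stack N n => v i) h1
    simp only [PiLp.zero_apply, PiLp.add_apply, PiLp.smul_apply, col_apply] at this
    rw [avg, map_smul, this]
    abel
  refine ⟨⟨⟨hx, hcoup⟩, fun i z hz => ?_⟩, avg l, fun i =>
    ⟨⟨a i, normalCone_block ha i, hstat i⟩, havgmem, hcoup, hinner⟩⟩
  have hzi : z ∈ g.Ω i := by simpa [deviate] using hz.1 i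
  have h3 := (hg.cost_convex i x hx).add_inner_gradient_le (hx i) hzi
    (hg.cost_diff i x hx _ (hx i))
  have h4 : gradient (g.ownCost i (others i x)) (x i) = -(a i) - (g.C i).adjoint (avg l) := by
    have h5 : g.pseudoGrad x i = gradient (g.ownCost i (others i x)) (x i) := rfl
    rw [← h5, ← sub_eq_zero, ← hstat i]
    abel
  have h5 := (normalCone_block ha i).2 z hzi
  -- By complementarity the left side equals the multiplier paired with the constraint at the
  -- deviation, which is feasible.
  have h6 : inner ℝ (avg l) (g.C i (z - x i)) ≤ 0 := by
    have h7 := coupling_deviate (g := g) x i z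
    have h8 : g.C i (z - x i) = g.coupling (deviate i x z) - g.coupling x := by rw [h7]; abel
    rw [h8, inner_sub_right, hinner, sub_zero, PiLp.inner_apply]
    refine Finset.sum_nonpos fun k _ => ?_
    simpa [mul_comm] using mul_nonpos_of_nonneg_of_nonpos (havgmem k) (hz.2 k)
  rw [h4, inner_sub_left, inner_neg_left, ContinuousLinearMap.adjoint_inner_left] at h3
  rw [ownCost, ownCost, ← avg_eq_add_others] at h3
  linarith

end AggGame

/-! ### Splitting of `T` and the preconditioner. -/

section Average

variable {N d : ℕ}

theorem avg_add (x y : Stack N d) : avg (x + y) = avg x + avg y := by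
  simp [avg, Finset.sum_add_distrib]

theorem avg_smul (r : ℝ) (x : Stack N d) : avg (r • x) = r • avg x := by
  simp [avg, ← Finset.smul_sum, smul_comm r]

theorem avg_sub (x y : Stack N d) : avg (x - y) = avg x - avg y := by
  simp [avg, smul_sub]

theorem natCast_smul_avg [NeZero N] (x : Stack N d) : (N : ℝ) • avg x = ∑ i, x i := by
  have : (N : ℝ) ≠ 0 := by exact_mod_cast NeZero.ne N
  rw [avg, smul_smul, mul_one_div_cancel this, one_smul]

theorem inner_col_const (v : Vec d) (l : Stack N d) :
    inner ℝ (col (fun _ : Fin N => (1 / (N : ℝ)) • v)) l = inner ℝ v (avg l) := by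
  rw [stack_inner, avg, real_inner_smul_right, inner_sum, Finset.mul_sum]
  simp [real_inner_smul_left]

/-- Removing the average is an orthogonal projection, hence `1`-cocoercive: the origin of the `1` in
`min 1 χ`. -/
theorem norm_sub_avg_sq [NeZero N] (l : Stack N d) :
    inner ℝ (col fun i => l i - avg l) l = ‖(col fun i => l i - avg l : Stack N d)‖ ^ 2 := by
  have h1 : l = (col fun i => l i - avg l) + col fun _ => avg l := by
    refine PiLp.ext fun i => ?_
    simp
  have h2 : inner ℝ (col fun i => l i - avg l : Stack N d) (col fun _ => avg l) = 0 := by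
    rw [stack_inner]
    simp only [col_apply, ← sum_inner]
    rw [Finset.sum_sub_distrib, ← natCast_smul_avg]
    simp [Nat.cast_smul_eq_nsmul]
  nth_rw 3 [h1]
  rw [inner_add_right, h2, add_zero, real_inner_self_eq_norm_sq]

theorem norm_avg_le_sum (x : Stack N d) : ‖avg x‖ ≤ ∑ i, ‖x i‖ := by
  rw [avg, norm_smul]
  have h1 : ‖(1 / (N : ℝ))‖ ≤ 1 := by
    rw [Real.norm_of_nonneg (by positivity)]
    rcases Nat.eq_zero_or_pos N with rfl | hN
    · simp
    · rw [div_le_one (by exact_mod_cast hN)]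
      exact_mod_cast hN
  calc _ ≤ 1 * ∑ i, ‖x i‖ := by
        gcongr
        exact norm_sum_le _ _
    _ = _ := one_mul _

end Average

namespace AggGame

variable {N n m : ℕ} (g : AggGame N n m)

/-- The space of primal-dual pairs. -/
abbrev PrimalDual (N n m : ℕ) := WithLp 2 (Stack N n × Stack N m)

theorem primalDual_ext {v w : PrimalDual N n m} (h1 : ∀ i, v.fst i = w.fst i)
    (h2 : ∀ i, v.snd i = w.snd i) : v = w :=
  WithLp.ofLp_injective 2 (Prod.ext (PiLp.ext h1) (PiLp.ext h2))

theorem primalDual_inner (v w : PrimalDual N n m) :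
    inner ℝ v w = inner ℝ v.fst w.fst + inner ℝ v.snd w.snd := WithLp.prod_inner_apply v w

/-- `∑_i C_i x_i`. -/
def total (x : Stack N n) : Vec m := ∑ i, g.C i (x i)

theorem total_add (x y : Stack N n) : g.total (x + y) = g.total x + g.total y := by
  simp [total, Finset.sum_add_distrib]

theorem total_smul (r : ℝ) (x : Stack N n) : g.total (r • x) = r • g.total x := by
  simp [total, Finset.smul_sum]

theorem total_sub (x y : Stack N n) : g.total (x - y) = g.total x - g.total y := by
  simp [total]

theorem coupling_eq_total (x : Stack N n) : g.coupling x = g.total x - ∑ i, g.c i := by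
  simp [coupling, total]

/-- `(x, λ) ↦ (col (C_iᵀ λ̄), s N⁻¹ C x)`; skew-symmetric for `s = -1`, symmetric for `s = 1`. -/
def couplingOp (s : ℝ) : PrimalDual N n m →ₗ[ℝ] PrimalDual N n m where
  toFun w := WithLp.toLp 2 (col fun i => (g.C i).adjoint (avg w.snd),
    s • col fun _ => (1 / (N : ℝ)) • g.total w.fst)
  map_add' v w := primalDual_ext (fun i => by simp [avg_add]) (fun i => by simp [total_add])
  map_smul' r w := primalDual_ext (fun i => by simp [avg_smul])
    (fun i => by
      simp only [WithLp.toLp_snd, PiLp.smul_apply, col_apply, WithLp.smul_fst, WithLp.smul_snd,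
        total_smul, RingHom.id_apply, smul_comm r])

theorem inner_col_adjoint (v : Vec m) (x : Stack N n) :
    inner ℝ (col fun i => (g.C i).adjoint v) x = inner ℝ v (g.total x) := by
  rw [stack_inner, total, inner_sum]
  simp [ContinuousLinearMap.adjoint_inner_left]

theorem inner_couplingOp (s : ℝ) (v w : PrimalDual N n m) :
    inner ℝ (g.couplingOp s v) w
      = inner ℝ (avg v.snd) (g.total w.fst) + s * inner ℝ (g.total v.fst) (avg w.snd) := by
  rw [primalDual_inner]
  simp only [couplingOp, LinearMap.coe_mk, AddHom.coe_mk, WithLp.toLp_fst, WithLp.toLp_snd]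
  rw [inner_col_adjoint, real_inner_smul_left, inner_col_const]

/-- The preconditioner. -/
def precond (α β : Fin N → ℝ) : PrimalDual N n m →ₗ[ℝ] PrimalDual N n m where
  toFun w := WithLp.toLp 2 (col fun i => (α i)⁻¹ • w.fst i, col fun i => (β i)⁻¹ • w.snd i)
    - g.couplingOp 1 w
  map_add' v w := by
    rw [map_add, ← add_sub_add_comm]
    congr 1
    exact primalDual_ext (fun i => by simp) (fun i => by simp)
  map_smul' r w := by
    rw [map_smul, RingHom.id_apply, smul_sub]
    congr 1
    exact primalDual_ext (fun i => by simp [smul_comm r]) (fun i => by simp [smul_comm r])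

theorem inner_precond (α β : Fin N → ℝ) (v w : PrimalDual N n m) :
    inner ℝ (g.precond α β v) w = ∑ i, (α i)⁻¹ * inner ℝ (v.fst i) (w.fst i)
      + ∑ i, (β i)⁻¹ * inner ℝ (v.snd i) (w.snd i)
      - (inner ℝ (avg v.snd) (g.total w.fst) + inner ℝ (g.total v.fst) (avg w.snd)) := by
  simp only [precond, LinearMap.coe_mk, AddHom.coe_mk]
  rw [inner_sub_left, inner_couplingOp, one_mul, primalDual_inner]
  simp only [WithLp.toLp_fst, WithLp.toLp_snd, stack_inner, col_apply, real_inner_smul_left]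

theorem isSymmetric_precond (α β : Fin N → ℝ) : (g.precond α β).IsSymmetric := by
  intro v w
  rw [real_inner_comm (g.precond α β w) v, inner_precond, inner_precond]
  simp only [real_inner_comm (v.fst _), real_inner_comm (v.snd _)]
  rw [real_inner_comm (avg v.snd), real_inner_comm (g.total v.fst)]
  ring

/-- Young's inequality on each pairing of `C_i x_i` with `λ_j` gives exactly the weights `‖C_i‖` and
`(1/N) ∑ ‖C_j‖` of the step-size bounds, so `τ` is left over. -/
theorem le_inner_precond [NeZero N] {χ δ τ : ℝ} {α β : Fin N → ℝ} (h : g.StepSizes χ δ τ α β)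
    (w : PrimalDual N n m) : τ * ‖w‖ ^ 2 ≤ inner ℝ (g.precond α β w) w := by
  have hN0 : (0 : ℝ) < N := by exact_mod_cast Nat.pos_of_ne_zero (NeZero.ne N)
  have hτ : 0 < τ := lt_trans (by have := h.δ_pos; positivity) h.τ_gt
  have hα : ∀ i, ‖g.C i‖ + τ ≤ (α i)⁻¹ := fun i => by
    rw [← inv_inv (‖g.C i‖ + τ)]
    exact inv_anti₀ (h.α_pos i) (h.α_le i)
  have hβ : ∀ i, 1 / (N : ℝ) * ∑ j, ‖g.C j‖ + τ ≤ (β i)⁻¹ := fun i => by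
    rw [← inv_inv (1 / (N : ℝ) * ∑ j, ‖g.C j‖ + τ)]
    exact inv_anti₀ (h.β_pos i) (h.β_le i)
  have hcross : 2 * inner ℝ (g.total w.fst) (avg w.snd)
      ≤ ∑ i, ‖g.C i‖ * ‖w.fst i‖ ^ 2 + 1 / (N : ℝ) * (∑ j, ‖g.C j‖) * ∑ i, ‖w.snd i‖ ^ 2 := by
    have h1 : inner ℝ (g.total w.fst) (avg w.snd)
        = 1 / (N : ℝ) * ∑ i, ∑ j, inner ℝ (g.C i (w.fst i)) (w.snd j) := by
      rw [total, avg, real_inner_smul_right, sum_inner]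
      simp only [inner_sum]
    have h2 : ∀ i j, 2 * inner ℝ (g.C i (w.fst i)) (w.snd j)
        ≤ ‖g.C i‖ * ‖w.fst i‖ ^ 2 + ‖g.C i‖ * ‖w.snd j‖ ^ 2 := by
      intro i j
      have a1 := real_inner_le_norm (g.C i (w.fst i)) (w.snd j)
      have a2 := mul_le_mul_of_nonneg_right ((g.C i).le_opNorm (w.fst i))
        (norm_nonneg (w.snd j))
      nlinarith [mul_nonneg (norm_nonneg (g.C i)) (sq_nonneg (‖w.fst i‖ - ‖w.snd j‖))]
    have h3 : ∑ i, ∑ j, 2 * inner ℝ (g.C i (w.fst i)) (w.snd j)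
        ≤ N * ∑ i, ‖g.C i‖ * ‖w.fst i‖ ^ 2 + (∑ j, ‖g.C j‖) * ∑ i, ‖w.snd i‖ ^ 2 := by
      refine (Finset.sum_le_sum fun i _ => Finset.sum_le_sum fun j _ => h2 i j).trans_eq ?_
      simp only [Finset.sum_add_distrib, Finset.sum_const, Finset.card_univ, Fintype.card_fin,
        nsmul_eq_mul, ← Finset.mul_sum, ← Finset.sum_mul]
    simp only [← Finset.mul_sum] at h3
    have h4 := mul_le_mul_of_nonneg_left h3 (by positivity : 0 ≤ 1 / (N : ℝ))
    have h5 : 1 / (N : ℝ) * (N * ∑ i, ‖g.C i‖ * ‖w.fst i‖ ^ 2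
          + (∑ j, ‖g.C j‖) * ∑ i, ‖w.snd i‖ ^ 2)
        = ∑ i, ‖g.C i‖ * ‖w.fst i‖ ^ 2 + 1 / (N : ℝ) * (∑ j, ‖g.C j‖) * ∑ i, ‖w.snd i‖ ^ 2 := by
      field_simp
    rw [h1]
    linarith
  have hx : ∑ i, (‖g.C i‖ + τ) * ‖w.fst i‖ ^ 2 ≤ ∑ i, (α i)⁻¹ * ‖w.fst i‖ ^ 2 :=
    Finset.sum_le_sum fun i _ => mul_le_mul_of_nonneg_right (hα i) (by positivity)
  have hl : ∑ i, (1 / (N : ℝ) * ∑ j, ‖g.C j‖ + τ) * ‖w.snd i‖ ^ 2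
      ≤ ∑ i, (β i)⁻¹ * ‖w.snd i‖ ^ 2 :=
    Finset.sum_le_sum fun i _ => mul_le_mul_of_nonneg_right (hβ i) (by positivity)
  rw [WithLp.prod_norm_sq_eq_of_L2, PiLp.norm_sq_eq_of_L2, PiLp.norm_sq_eq_of_L2, inner_precond]
  rw [real_inner_comm (g.total w.fst)]
  simp only [real_inner_self_eq_norm_sq, add_mul, Finset.sum_add_distrib, ← Finset.mul_sum]
    at hx hl ⊢
  rw [mul_add]
  linarith

/-- The cocoercive part of `T`. -/
def forwardOp (w : PrimalDual N n m) : PrimalDual N n m :=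
  WithLp.toLp 2 (g.pseudoGrad w.fst,
    (col fun i => w.snd i - avg w.snd) + col fun _ => (1 / (N : ℝ)) • ∑ i, g.c i)

theorem cocoercive_forwardOp [NeZero N] {χ δ : ℝ} (hδ : δ ≤ min 1 χ)
    (hF : g.Cocoercive χ) {v w : PrimalDual N n m} (hv : v.fst ∈ prodSet g.Ω)
    (hw : w.fst ∈ prodSet g.Ω) :
    δ * ‖g.forwardOp v - g.forwardOp w‖ ^ 2
      ≤ inner ℝ (g.forwardOp v - g.forwardOp w) (v - w) := by
  have h1 : g.forwardOp v - g.forwardOp w = WithLp.toLp 2 (g.pseudoGrad v.fst - g.pseudoGrad w.fst,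
      col fun i => (v.snd - w.snd) i - avg (v.snd - w.snd)) := by
    refine primalDual_ext (fun i => by simp [forwardOp]) (fun i => ?_)
    simp only [forwardOp, WithLp.sub_snd, WithLp.toLp_snd, PiLp.sub_apply, PiLp.add_apply,
      col_apply, avg_sub]
    abel
  rw [h1, primalDual_inner, WithLp.prod_norm_sq_eq_of_L2]
  simp only [WithLp.toLp_fst, WithLp.toLp_snd, WithLp.sub_fst, WithLp.sub_snd]
  rw [norm_sub_avg_sq, mul_add]
  refine add_le_add (le_trans ?_ (hF _ hv _ hw)) ?_
  · exact mul_le_mul_of_nonneg_right (hδ.trans (min_le_right _ _)) (by positivity)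
  · exact mul_le_of_le_one_left (by positivity) (hδ.trans (min_le_left _ _))

end AggGame

/-! ### Disagreement bounds for dynamic average tracking. -/

/-- Doubly stochastic matrices whose products converge to the averaging matrix at rate `ρ`,
uniformly in the starting time. -/
structure MixesGeometrically {N : ℕ} (W : ℕ → Matrix (Fin N) (Fin N) ℝ) (C ρ : ℝ) : Prop where
  nonneg : ∀ k i l, 0 ≤ W k i l
  row : ∀ k i, ∑ l, W k i l = 1
  col : ∀ k l, ∑ i, W k i l = 1
  C_pos : 0 < C
  ρ_pos : 0 < ρ
  ρ_lt_one : ρ < 1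
  transition_le : ∀ j t i l, |transition W j t i l - 1 / (N : ℝ)| ≤ C * ρ ^ t

theorem IsMixing.exists_mixesGeometrically {N : ℕ} [NeZero N] {G : ℕ → SimpleGraph (Fin N)}
    (hG : QConnected G) {W : ℕ → Matrix (Fin N) (Fin N) ℝ} (hW : IsMixing G W) :
    (∃ C ρ, MixesGeometrically W C ρ) ∧ ∃ ε, 0 < ε ∧ ε ≤ 1 ∧ ∀ k i, ε ≤ W k i i := by
  obtain ⟨ε, hε, hW⟩ := hW
  have hdiag : ∀ k i, ε ≤ W k i i := fun k i => ((hW k).2.1 i).le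
  have hadj : ∀ k i l, (G k).Adj i l → ε ≤ W k i l := fun k i l h =>
    ((hW k).1 i l h.ne).1 h
  have hnn : ∀ k i l, 0 ≤ W k i l := by
    intro k i l
    by_cases hil : i = l
    · subst hil; exact hε.le.trans (hdiag k i)
    · by_cases h : (G k).Adj i l
      · exact hε.le.trans (hadj k i l h)
      · exact (((hW k).1 i l hil).2 h).ge
  have hrow : ∀ k i, ∑ l, W k i l = 1 := fun k => (hW k).2.2.1
  have hcol : ∀ k l, ∑ i, W k i l = 1 := fun k => (hW k).2.2.2
  obtain ⟨T, hT⟩ := exists_le_transition hG hε hnn hdiag hadj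
  obtain ⟨C, ρ, hC, hρ, hρ1, h⟩ := exists_abs_transition_sub_le (pow_pos hε T) hnn hrow hcol hT
  refine ⟨⟨C, ρ, hnn, hrow, hcol, hC, hρ, hρ1, h⟩, ε, hε, (hdiag 0 0).trans ?_, hdiag⟩
  rw [← hrow 0 0]
  exact Finset.single_le_sum (f := fun l => W 0 0 l) (fun l _ => hnn 0 0 l) (Finset.mem_univ 0)

section Tracking

variable {N d : ℕ} {W : ℕ → Matrix (Fin N) (Fin N) ℝ} {C ρ : ℝ}

theorem MixesGeometrically.avg_mix (hW : MixesGeometrically W C ρ) (k : ℕ) (v : Stack N d) :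
    avg (mix (W k) v) = avg v := by
  simp only [avg, mix, col_apply]
  rw [Finset.sum_comm]
  simp only [← Finset.sum_smul, hW.col, one_smul]

theorem MixesGeometrically.norm_mix_sub_le (hW : MixesGeometrically W C ρ) (k : ℕ)
    {v : Stack N d} {w : Vec d} {b : ℝ} (hv : ∀ i, ‖v i - w‖ ≤ b) (i : Fin N) :
    ‖mix (W k) v i - w‖ ≤ b := by
  have h1 : mix (W k) v i - w = ∑ j, W k i j • (v j - w) := by
    simp only [mix, col_apply, smul_sub, Finset.sum_sub_distrib, ← Finset.sum_smul, hW.row,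
      one_smul]
  rw [h1]
  calc _ ≤ ∑ j, W k i j * b := by
        refine (norm_sum_le _ _).trans (Finset.sum_le_sum fun j _ => ?_)
        rw [norm_smul, Real.norm_of_nonneg (hW.nonneg _ _ _)]
        exact mul_le_mul_of_nonneg_left (hv j) (hW.nonneg _ _ _)
    _ = b := by rw [← Finset.sum_mul, hW.row, one_mul]

theorem MixesGeometrically.avg_tracking (hW : MixesGeometrically W C ρ) {v p : ℕ → Stack N d}
    (hv : ∀ k, v (k + 1) = mix (W k) (v k) + (p (k + 1) - p k)) (k : ℕ) :
    avg (v k) = avg (p k) + (avg (v 0) - avg (p 0)) := by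
  induction k with
  | zero => abel
  | succ k ih =>
    rw [hv, avg_add, hW.avg_mix, ih, avg_sub]
    abel

/-- The total increment of the blocks of `p` at time `k`. -/
def increment (p : ℕ → Stack N d) (k : ℕ) : ℝ := ∑ i, ‖p (k + 1) i - p k i‖

theorem increment_nonneg (p : ℕ → Stack N d) (k : ℕ) : 0 ≤ increment p k :=
  Finset.sum_nonneg fun _ _ => norm_nonneg _

theorem norm_sub_le_increment (p : ℕ → Stack N d) (k : ℕ) (i : Fin N) :
    ‖p (k + 1) i - p k i‖ ≤ increment p k :=
  Finset.single_le_sum (f := fun i => ‖p (k + 1) i - p k i‖) (fun _ _ => norm_nonneg _)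
    (Finset.mem_univ i)

/-- `b` bounds the disagreement of the variables `v` that track the average of `p`. -/
structure IsTrackingBound (W : ℕ → Matrix (Fin N) (Fin N) ℝ) (C ρ : ℝ) (v p : ℕ → Stack N d)
    (b : ℕ → ℝ) : Prop where
  nonneg : ∀ k, 0 ≤ b k
  succ : ∀ k, b (k + 1) = ρ * b k + C * increment p k
  norm_sub_le : ∀ k i, ‖v k i - avg (v k)‖ ≤ b k
  norm_mix_sub_le : ∀ k i, ‖mix (W k) (v k) i - avg (v k)‖ ≤ b k
  norm_mix_succ_sub_le : ∀ k i, ‖mix (W (k + 1)) (v (k + 1)) i - mix (W k) (v k) i‖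
    ≤ b (k + 1) + b k + increment p k

theorem MixesGeometrically.exists_isTrackingBound (hW : MixesGeometrically W C ρ)
    {v p : ℕ → Stack N d} (hv : ∀ k, v (k + 1) = mix (W k) (v k) + (p (k + 1) - p k)) :
    ∃ b, IsTrackingBound W C ρ v p b := by
  have hb := norm_sub_mean_le hW.col hW.transition_le (j := 0) (v := fun k i => v k i)
    (u := fun k i => p (k + 1) i - p k i) (fun t i => by simp [hv, mix])
  have h1 : ∀ k i, ‖mix (W k) (v k) i - avg (v k)‖
      ≤ C * (ρ ^ k * ∑ l, ‖v 0 l‖ + geomConv ρ (increment p) k) := fun k i =>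
    hW.norm_mix_sub_le k (fun i => hb k i) i
  refine ⟨fun k => C * (ρ ^ k * ∑ l, ‖v 0 l‖ + geomConv ρ (increment p) k), fun k => ?_,
    fun k => ?_, fun k i => hb k i, h1, fun k i => ?_⟩
  · have := hW.C_pos
    have := hW.ρ_pos
    have := geomConv_nonneg hW.ρ_pos.le (increment_nonneg p) k
    positivity
  · rw [geomConv_succ]
    ring
  · have h2 : ‖avg (v (k + 1)) - avg (v k)‖ ≤ increment p k := by
      rw [hW.avg_tracking hv (k + 1), hW.avg_tracking hv k, add_sub_add_right_eq_sub, ← avg_sub]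
      exact norm_avg_le_sum _
    have h3 : mix (W (k + 1)) (v (k + 1)) i - mix (W k) (v k) i
        = (mix (W (k + 1)) (v (k + 1)) i - avg (v (k + 1)))
          - (mix (W k) (v k) i - avg (v k)) + (avg (v (k + 1)) - avg (v k)) := by abel
    rw [h3]
    refine (norm_add_le _ _).trans (add_le_add ((norm_sub_le _ _).trans
      (add_le_add (h1 _ _) (h1 _ _))) h2)

variable {v p : ℕ → Stack N d} {b γ : ℕ → ℝ}

theorem IsTrackingBound.bounded (hb : IsTrackingBound W C ρ v p b)
    (hW : MixesGeometrically W C ρ) {M : ℝ} (hM : ∀ k, increment p k ≤ M) :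
    ∃ B, ∀ k, b k ≤ B :=
  ⟨_, le_of_contraction hW.ρ_pos.le hW.ρ_lt_one (fun k => (hb.succ k).le)
    fun k => mul_le_mul_of_nonneg_left (hM k) hW.C_pos.le⟩

theorem IsTrackingBound.tendsto_zero (hb : IsTrackingBound W C ρ v p b)
    (hW : MixesGeometrically W C ρ) (hp : Tendsto (increment p) atTop (𝓝 0)) :
    Tendsto b atTop (𝓝 0) :=
  tendsto_zero_of_contraction hW.ρ_pos.le hW.ρ_lt_one hb.nonneg (fun k => (hb.succ k).le)
    (by simpa using hp.const_mul C)

/-- Since `γ` is non-increasing, `γ k * b k` inherits the contraction of `b`. The shifted series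
serves terms such as `y (k + 1)`, which enters step `k`. -/
theorem IsTrackingBound.summable (hb : IsTrackingBound W C ρ v p b)
    (hW : MixesGeometrically W C ρ) (h0 : ∀ k, 0 ≤ γ k) (hanti : ∀ k, γ (k + 1) ≤ γ k)
    (hs : Summable fun k => γ k * increment p k) :
    (Summable fun k => γ k * b k) ∧ Summable fun k => γ k * b (k + 1) := by
  have h1 : Summable fun k => C * (γ k * increment p k) := hs.mul_left C
  have h2 : Summable fun k => γ k * b k := by
    refine summable_of_contraction hW.ρ_lt_one (fun k => mul_nonneg (h0 k) (hb.nonneg k))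
      (fun k => ?_) (fun k => mul_nonneg hW.C_pos.le (mul_nonneg (h0 k) (increment_nonneg p k))) h1
    calc γ (k + 1) * b (k + 1) ≤ γ k * b (k + 1) :=
          mul_le_mul_of_nonneg_right (hanti k) (hb.nonneg _)
      _ = _ := by rw [hb.succ]; ring
  refine ⟨h2, ((h2.mul_left ρ).add h1).congr fun k => ?_⟩
  rw [hb.succ]
  ring

end Tracking

/-- If the relaxed steps have bounded targets, the increments are of the order of `γ`. -/
theorem increment_le_of_relaxation {N d : ℕ} {x xt : ℕ → Stack N d} {γ : ℕ → ℝ} (h0 : ∀ k, 0 ≤ γ k)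
    (hx : ∀ k, x (k + 1) = x k + γ k • (xt k - x k)) {R : ℝ} (hR : ∀ k i, ‖x k i‖ ≤ R)
    (hRt : ∀ k i, ‖xt k i‖ ≤ R) : ∀ k, increment x k ≤ γ k * (N * (2 * R)) := by
  intro k
  have h1 : ∀ i, ‖x (k + 1) i - x k i‖ ≤ γ k * (2 * R) := by
    intro i
    rw [hx, PiLp.add_apply, add_sub_cancel_left, PiLp.smul_apply, norm_smul,
      Real.norm_of_nonneg (h0 k), PiLp.sub_apply]
    refine mul_le_mul_of_nonneg_left ((norm_sub_le _ _).trans ?_) (h0 k)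
    linarith [hR k i, hRt k i]
  refine (Finset.sum_le_sum fun i _ => h1 i).trans_eq ?_
  simp only [Finset.sum_const, Finset.card_univ, Fintype.card_fin, nsmul_eq_mul]
  ring

theorem VanishingSteps.tendsto_zero {γ : ℕ → ℝ} (h : VanishingSteps γ) :
    Tendsto γ atTop (𝓝 0) := by
  have h1 := h.sq_summable.tendsto_atTop_zero.sqrt
  simpa [Real.sqrt_sq (h.nonneg _)] using h1

/-! ### Trajectories: invariance and boundedness. -/

namespace AggGame

variable {N n m : ℕ} {g : AggGame N n m}

/-- The sequences generated by the algorithm; `d k` collects the vectors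
`C_i (2 x̃_i^{k-1} - x_i^{k-1})` whose average is tracked by `y k`. -/
structure IsTrajectory (g : AggGame N n m) (α β : Fin N → ℝ) (W : ℕ → Matrix (Fin N) (Fin N) ℝ)
    (γ : ℕ → ℝ) (x xt σ : ℕ → Stack N n) (lam lt y z d : ℕ → Stack N m) : Prop where
  x_mem : x 0 ∈ prodSet g.Ω
  lam_mem : lam 0 ∈ prodSet fun _ : Fin N => orthant m
  σ_zero : σ 0 = x 0
  z_zero : z 0 = lam 0
  y_zero : y 0 = d 0 - col g.c
  xt_eq : ∀ k i, xt k i = proj (g.Ω i) (x k i - α i •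
    (g.partialGrad i (x k i) (mix (W k) (σ k) i) + (g.C i).adjoint (mix (W k) (z k) i)))
  lt_eq : ∀ k i, lt k i = proj (orthant m) (lam k i + β i •
    (y (k + 1) i - lam k i + mix (W k) (z k) i))
  x_succ : ∀ k, x (k + 1) = x k + γ k • (xt k - x k)
  lam_succ : ∀ k, lam (k + 1) = lam k + γ k • (lt k - lam k)
  σ_succ : ∀ k, σ (k + 1) = mix (W k) (σ k) + (x (k + 1) - x k)
  z_succ : ∀ k, z (k + 1) = mix (W k) (z k) + (lam (k + 1) - lam k)
  y_succ : ∀ k, y (k + 1) = mix (W k) (y k) + (d (k + 1) - d k)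
  d_succ : ∀ k i, d (k + 1) i = g.C i ((2 : ℝ) • xt k i - x k i)

theorem isTrajectory_alg (α β : Fin N → ℝ) (W : ℕ → Matrix (Fin N) (Fin N) ℝ) (γ : ℕ → ℝ)
    {xm xtm x0 : Stack N n} {l0 : Stack N m} (hx0 : x0 ∈ prodSet g.Ω)
    (hl0 : l0 ∈ prodSet fun _ : Fin N => orthant m) :
    ∃ xt σ lt y z d, g.IsTrajectory α β W γ (fun k => (g.alg α β W γ xm xtm x0 l0 k).x) xt σ
      (fun k => (g.alg α β W γ xm xtm x0 l0 k).lam) lt y z d := by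
  set s := g.alg α β W γ xm xtm x0 l0 with hs
  have hstep : ∀ k, s (k + 1) = g.algStep α β (W k) (γ k) (s k) := fun k => rfl
  refine ⟨fun k => (s (k + 1)).xtPrev, fun k => (s k).σ, fun k => col fun i =>
    proj (orthant m) ((s k).lam i + β i •
      ((s (k + 1)).y i - (s k).lam i + mix (W k) (s k).z i)), fun k => (s k).y, fun k => (s k).z,
    fun k => col fun i => g.C i ((2 : ℝ) • (s k).xtPrev i - (s k).xPrev i),
    hx0, hl0, rfl, rfl, ?_, fun k i => rfl, fun k i => rfl, fun k => rfl, fun k => rfl,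
    fun k => ?_, fun k => ?_, fun k => ?_, fun k i => rfl⟩
  · refine PiLp.ext fun i => ?_
    change (2 : ℝ) • g.C i (xtm i) - g.C i (xm i) - g.c i = g.C i ((2 : ℝ) • xtm i - xm i) - g.c i
    rw [map_sub, map_smul]
  · exact add_sub_assoc _ _ _
  · exact add_sub_assoc _ _ _
  · exact PiLp.ext fun i => add_sub_assoc _ _ _

section

variable {α β : Fin N → ℝ} {W : ℕ → Matrix (Fin N) (Fin N) ℝ} {γ : ℕ → ℝ}
  {x xt σ : ℕ → Stack N n} {lam lt y z d : ℕ → Stack N m}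

theorem IsTrajectory.xt_mem (h : g.IsTrajectory α β W γ x xt σ lam lt y z d) (hg : g.Standard)
    (k : ℕ) : xt k ∈ prodSet g.Ω := fun i => by
  rw [h.xt_eq]
  exact proj_mem (hg.compact i).isClosed (hg.nonempty i) _

theorem IsTrajectory.lt_mem (h : g.IsTrajectory α β W γ x xt σ lam lt y z d) (k : ℕ) :
    lt k ∈ prodSet fun _ : Fin N => orthant m := fun i => by
  rw [h.lt_eq]
  exact proj_mem (isClosed_orthant m) ⟨0, zero_mem_orthant m⟩ _

theorem IsTrajectory.x_mem_all (h : g.IsTrajectory α β W γ x xt σ lam lt y z d)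
    (hg : g.Standard) (hγ : VanishingSteps γ) (k : ℕ) : x k ∈ prodSet g.Ω := by
  induction k with
  | zero => exact h.x_mem
  | succ k ih =>
    rw [h.x_succ]
    exact (convex_prodSet hg.convex).add_smul_sub_mem ih (h.xt_mem hg k)
      ⟨hγ.nonneg k, hγ.le_one k⟩

theorem IsTrajectory.lam_mem_all (h : g.IsTrajectory α β W γ x xt σ lam lt y z d)
    (hγ : VanishingSteps γ) (k : ℕ) : lam k ∈ prodSet fun _ : Fin N => orthant m := by
  induction k with
  | zero => exact h.lam_mem
  | succ k ih =>
    rw [h.lam_succ]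
    exact (convex_prodSet fun _ => convex_orthant m).add_smul_sub_mem ih (h.lt_mem k)
      ⟨hγ.nonneg k, hγ.le_one k⟩

theorem Standard.exists_norm_le (hg : g.Standard) :
    ∃ R, 0 ≤ R ∧ ∀ v ∈ prodSet g.Ω, ∀ i, ‖v i‖ ≤ R := by
  obtain ⟨R, hR⟩ := (isCompact_iUnion hg.compact).isBounded.exists_norm_le
  exact ⟨max R 0, le_max_right _ _, fun v hv i =>
    (hR _ (Set.mem_iUnion.2 ⟨i, hv i⟩)).trans (le_max_left _ _)⟩

theorem LipschitzOver.exists_block {S : Set (Vec n)} (h : g.LipschitzOver S) :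
    ∃ L, 0 < L ∧ ∀ v ∈ prodSet g.Ω, ∀ u ∈ prodSet g.Ω,
      ∀ w ∈ prodSet (fun _ : Fin N => S), ∀ z ∈ prodSet (fun _ : Fin N => S), ∀ i,
        ‖g.partialGrad i (v i) (w i) - g.partialGrad i (u i) (z i)‖
          ≤ L * (∑ j, ‖v j - u j‖ + ∑ j, ‖w j - z j‖) := by
  obtain ⟨L, hL, h⟩ := h
  refine ⟨L, hL, fun v hv u hu w hw z hz i => ?_⟩
  have h1 := norm_block_le (g.extPseudoGrad v w - g.extPseudoGrad u z) i
  refine (h1.trans (h v hv u hu w hw z hz)).trans (mul_le_mul_of_nonneg_left ?_ hL.le)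
  refine (Real.sqrt_le_iff.2 ⟨by positivity, ?_⟩ : _ ≤ ‖v - u‖ + ‖w - z‖).trans
    (add_le_add (norm_le_sum_norm (v - u)) (norm_le_sum_norm (w - z)))
  nlinarith [mul_nonneg (norm_nonneg (v - u)) (norm_nonneg (w - z))]

theorem IsTrajectory.avg_y (h : g.IsTrajectory α β W γ x xt σ lam lt y z d) {C ρ : ℝ}
    (hW : MixesGeometrically W C ρ) (k : ℕ) : avg (y k) = avg (d k) - avg (col g.c) := by
  rw [hW.avg_tracking h.y_succ, h.y_zero, avg_sub]
  abel

theorem IsTrajectory.avg_z (h : g.IsTrajectory α β W γ x xt σ lam lt y z d) {C ρ : ℝ}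
    (hW : MixesGeometrically W C ρ) (k : ℕ) : avg (z k) = avg (lam k) := by
  rw [hW.avg_tracking h.z_succ, h.z_zero, sub_self, add_zero]

theorem IsTrajectory.avg_σ (h : g.IsTrajectory α β W γ x xt σ lam lt y z d) {C ρ : ℝ}
    (hW : MixesGeometrically W C ρ) (k : ℕ) : avg (σ k) = avg (x k) := by
  rw [hW.avg_tracking h.σ_succ, h.σ_zero, sub_self, add_zero]

/-- The mixed aggregate estimates eventually stay where the extended pseudo-gradient is
Lipschitz. -/
theorem IsTrajectory.exists_lipschitzOver [NeZero N]
    (h : g.IsTrajectory α β W γ x xt σ lam lt y z d) (hg : g.Standard) (hγ : VanishingSteps γ)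
    {C ρ ε : ℝ} (hW : MixesGeometrically W C ρ) (hε : 0 < ε) (hε1 : ε ≤ 1)
    (hdiag : ∀ k i, ε ≤ W k i i) (hL : g.LipschitzOver g.hull)
    (hL' : γ 0 = 1 → ∃ r : ℝ, 0 < r ∧ g.LipschitzOver (Metric.thickening r g.hull))
    {b : ℕ → ℝ} (hb : IsTrackingBound W C ρ σ x b) (hb0 : Tendsto b atTop (𝓝 0)) :
    ∃ S, g.LipschitzOver S ∧ g.hull ⊆ S ∧
      ∃ K, ∀ k ≥ K, mix (W k) (σ k) ∈ prodSet fun _ : Fin N => S := by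
  have hsub : ∀ i, g.Ω i ⊆ g.hull := fun i v hv =>
    subset_convexHull ℝ _ (Set.mem_iUnion.2 ⟨i, hv⟩)
  have hconv : Convex ℝ g.hull := convex_convexHull ℝ _
  -- Below `1`, nonnegative responses bring `σ` into the hull. At `1`, the estimates are only known
  -- to approach the average of `x`, a point of the hull.
  rcases (hγ.le_one 0).lt_or_eq with h1 | h1
  · obtain ⟨K, hK⟩ := exists_response_nonneg hW.C_pos hW.ρ_pos hW.ρ_lt_one hε hε1 hW.nonneg
      hdiag hW.col hW.transition_le (antitone_nat_of_succ_le hγ.anti) hγ.nonneg hγ.le_one h1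
      hγ.tendsto_zero
    refine ⟨g.hull, hL, subset_rfl, K, fun k hk i => ?_⟩
    have hσ : ∀ j, σ k j ∈ g.hull := tracking_mem_of_response_nonneg hconv hW.row
      hγ.nonneg hK (x := fun k i => x k i) (xt := fun k i => xt k i) (s := fun k i => σ k i)
      (fun k i => by simp [h.x_succ]) (fun k i => by simp [h.σ_succ, mix])
      (by simp [h.σ_zero]) (fun i => hsub i (h.x_mem i)) (fun k i => hsub i (h.xt_mem hg k i)) hk
    exact hconv.sum_mem (fun j _ => hW.nonneg k i j) (hW.row k i) fun j _ => hσ j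
  · obtain ⟨r, hr, hLr⟩ := hL' h1
    obtain ⟨K, hK⟩ := eventually_atTop.1 (hb0.eventually_lt_const hr)
    refine ⟨_, hLr, Metric.self_subset_thickening hr _, K, fun k hk i => ?_⟩
    refine Metric.mem_thickening_iff.2 ⟨avg (x k), avg_mem_hull (h.x_mem_all hg hγ k), ?_⟩
    rw [dist_eq_norm, ← h.avg_σ hW]
    exact (hb.norm_mix_sub_le k i).trans_lt (hK k hk)

theorem norm_proj_orthant_le (v : Vec m) : ‖proj (orthant m) v‖ ≤ ‖v‖ := by
  have hc := isClosed_orthant m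
  have h0 := zero_mem_orthant m
  have h1 : proj (orthant m) 0 = 0 := by
    have := (proj_spec hc ⟨0, h0⟩ (0 : Vec m)).2 0 h0
    simpa using this
  have h2 := norm_proj_sub_proj_le hc (convex_orthant m) ⟨0, h0⟩ v 0
  rwa [h1, sub_zero, sub_zero] at h2

theorem increment_le_of_bounded {N d : ℕ} {p : ℕ → Stack N d} {R : ℝ}
    (hR : ∀ k i, ‖p k i‖ ≤ R) (k : ℕ) : increment p k ≤ N * (2 * R) := by
  refine (Finset.sum_le_sum fun i _ => (norm_sub_le _ _).trans
    (add_le_add (hR (k + 1) i) (hR k i))).trans_eq ?_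
  simp only [Finset.sum_const, Finset.card_univ, Fintype.card_fin, nsmul_eq_mul]
  ring

theorem norm_avg_le_of_bounded {N d : ℕ} {p : Stack N d} {R : ℝ}
    (hR : ∀ i, ‖p i‖ ≤ R) : ‖avg p‖ ≤ N * R := by
  refine (norm_avg_le_sum p).trans ((Finset.sum_le_sum fun i _ => hR i).trans_eq ?_)
  simp

theorem IsTrajectory.exists_norm_d_le (h : g.IsTrajectory α β W γ x xt σ lam lt y z d)
    (hg : g.Standard) (hγ : VanishingSteps γ) : ∃ R, ∀ k i, ‖d k i‖ ≤ R := by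
  obtain ⟨R, hR0, hR⟩ := hg.exists_norm_le
  refine ⟨∑ i, ‖d 0 i‖ + (∑ i, ‖g.C i‖) * (3 * R), fun k i => ?_⟩
  have hd0 : ‖d 0 i‖ ≤ ∑ i, ‖d 0 i‖ := Finset.single_le_sum (f := fun i => ‖d 0 i‖)
    (fun _ _ => norm_nonneg _) (Finset.mem_univ i)
  have hCi : ‖g.C i‖ ≤ ∑ i, ‖g.C i‖ := Finset.single_le_sum (f := fun i => ‖g.C i‖)
    (fun _ _ => norm_nonneg _) (Finset.mem_univ i)
  have hnn : 0 ≤ (∑ i, ‖g.C i‖) * (3 * R) :=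
    mul_nonneg ((norm_nonneg _).trans hCi) (by positivity)
  cases k with
  | zero => linarith
  | succ k =>
    have h1 : ‖(2 : ℝ) • xt k i - x k i‖ ≤ 3 * R := by
      refine (norm_sub_le _ _).trans ?_
      rw [norm_smul, Real.norm_two]
      linarith [hR _ (h.xt_mem hg k) i, hR _ (h.x_mem_all hg hγ k) i]
    have h2 : ‖d (k + 1) i‖ ≤ (∑ i, ‖g.C i‖) * (3 * R) := by
      rw [h.d_succ]
      exact ((g.C i).le_opNorm _).trans (mul_le_mul hCi h1 (norm_nonneg _)
        ((norm_nonneg _).trans hCi))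
    linarith [norm_nonneg (d 0 i)]

/-- Bounded signals have bounded increments, hence bounded tracking variables, hence bounded dual
targets. Only then are the increments of `lam` known to be of order `γ`. -/
theorem IsTrajectory.exists_norm_lt_le (h : g.IsTrajectory α β W γ x xt σ lam lt y z d)
    (hg : g.Standard) (hγ : VanishingSteps γ) {C ρ : ℝ} (hW : MixesGeometrically W C ρ)
    {B : ℝ} (hB : ∀ k, ‖lam k‖ ≤ B) : ∃ R, ∀ k i, ‖lt k i‖ ≤ R := by
  obtain ⟨Rd, hRd⟩ := h.exists_norm_d_le hg hγ
  obtain ⟨bd, hby⟩ := hW.exists_isTrackingBound h.y_succ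
  obtain ⟨bz, hbz⟩ := hW.exists_isTrackingBound h.z_succ
  have hlam : ∀ k i, ‖lam k i‖ ≤ B := fun k i => (norm_block_le _ _).trans (hB k)
  obtain ⟨My, hMy⟩ := hby.bounded hW (increment_le_of_bounded hRd)
  obtain ⟨Mz, hMz⟩ := hbz.bounded hW (increment_le_of_bounded hlam)
  set Ry : ℝ := My + (N * Rd + ‖avg (col g.c)‖) with hRy
  have hy : ∀ k i, ‖y k i‖ ≤ Ry := by
    intro k i
    have h1 : ‖avg (y k)‖ ≤ N * Rd + ‖avg (col g.c)‖ := by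
      rw [h.avg_y hW]
      exact (norm_sub_le _ _).trans (by gcongr; exact norm_avg_le_of_bounded (hRd k))
    have h2 := norm_sub_norm_le (y k i) (avg (y k))
    linarith [hby.norm_sub_le k i, hMy k]
  have hz : ∀ k i, ‖mix (W k) (z k) i‖ ≤ Mz + N * B := by
    intro k i
    have h1 : ‖avg (z k)‖ ≤ N * B := by
      rw [h.avg_z hW]
      exact norm_avg_le_of_bounded (hlam k)
    have h2 := norm_sub_norm_le (mix (W k) (z k) i) (avg (z k))
    linarith [hbz.norm_mix_sub_le k i, hMz k]
  refine ⟨B + (∑ i, |β i|) * (Ry + B + (Mz + N * B)), fun k i => ?_⟩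
  have hβi : |β i| ≤ ∑ i, |β i| := Finset.single_le_sum (f := fun i => |β i|)
    (fun _ _ => abs_nonneg _) (Finset.mem_univ i)
  rw [h.lt_eq]
  refine (norm_proj_orthant_le _).trans ((norm_add_le _ _).trans (add_le_add (hlam k i) ?_))
  rw [norm_smul, Real.norm_eq_abs]
  refine mul_le_mul hβi ?_ (norm_nonneg _) ((abs_nonneg _).trans hβi)
  exact (norm_add_le _ _).trans (add_le_add ((norm_sub_le _ _).trans
    (add_le_add (hy _ _) (hlam _ _))) (hz _ _))

end

end AggGame

/-! ### Summability of the consensus error and convergence. -/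

namespace AggGame

variable {N n m : ℕ} {g : AggGame N n m} {α β : Fin N → ℝ} {W : ℕ → Matrix (Fin N) (Fin N) ℝ}
  {γ : ℕ → ℝ} {x xt σ : ℕ → Stack N n} {lam lt y z d : ℕ → Stack N m} {C ρ : ℝ} {bσ bz : ℕ → ℝ}

theorem norm_adjoint_apply_le (i : Fin N) (v : Vec m) : ‖(g.C i).adjoint v‖ ≤ ‖g.C i‖ * ‖v‖ := by
  refine ((g.C i).adjoint.le_opNorm v).trans_eq ?_
  rw [LinearIsometryEquiv.norm_map]

theorem IsTrajectory.norm_xt_succ_sub_le (h : g.IsTrajectory α β W γ x xt σ lam lt y z d)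
    (hg : g.Standard) (hγ : VanishingSteps γ)
    (hbσ : IsTrackingBound W C ρ σ x bσ) (hbz : IsTrackingBound W C ρ z lam bz)
    {S : Set (Vec n)} {L : ℝ} (hL0 : 0 < L)
    (hL : ∀ v ∈ prodSet g.Ω, ∀ u ∈ prodSet g.Ω,
      ∀ w ∈ prodSet (fun _ : Fin N => S), ∀ z ∈ prodSet (fun _ : Fin N => S), ∀ i,
        ‖g.partialGrad i (v i) (w i) - g.partialGrad i (u i) (z i)‖
          ≤ L * (∑ j, ‖v j - u j‖ + ∑ j, ‖w j - z j‖))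
    {k : ℕ} (hS : mix (W k) (σ k) ∈ prodSet fun _ : Fin N => S)
    (hS' : mix (W (k + 1)) (σ (k + 1)) ∈ prodSet fun _ : Fin N => S) (i : Fin N) :
    ‖xt (k + 1) i - xt k i‖ ≤ increment x k + |α i| *
      (L * (increment x k + N * (bσ (k + 1) + bσ k + increment x k))
        + ‖g.C i‖ * (bz (k + 1) + bz k + increment lam k)) := by
  have h1 := hL _ (h.x_mem_all hg hγ (k + 1)) _ (h.x_mem_all hg hγ k) _ hS' _ hS i
  have h2 : ∑ j, ‖mix (W (k + 1)) (σ (k + 1)) j - mix (W k) (σ k) j‖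
      ≤ N * (bσ (k + 1) + bσ k + increment x k) := by
    refine (Finset.sum_le_sum fun j _ => hbσ.norm_mix_succ_sub_le k j).trans_eq ?_
    simp only [Finset.sum_const, Finset.card_univ, Fintype.card_fin, nsmul_eq_mul]
  have h3 : ‖(g.C i).adjoint (mix (W (k + 1)) (z (k + 1)) i - mix (W k) (z k) i)‖
      ≤ ‖g.C i‖ * (bz (k + 1) + bz k + increment lam k) :=
    (norm_adjoint_apply_le i _).trans
      (mul_le_mul_of_nonneg_left (hbz.norm_mix_succ_sub_le k i) (norm_nonneg _))
  rw [h.xt_eq, h.xt_eq]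
  refine (norm_proj_sub_proj_le (hg.compact i).isClosed (hg.convex i) (hg.nonempty i) _ _).trans ?_
  have e1 : ∀ (a b p p' q q' : Vec n) (r : ℝ), a - r • (p + q) - (b - r • (p' + q'))
      = (a - b) - r • ((p - p') + (q - q')) := fun a b p p' q q' r => by module
  rw [e1, ← map_sub]
  refine (norm_sub_le _ _).trans (add_le_add (norm_sub_le_increment x k i) ?_)
  rw [norm_smul, Real.norm_eq_abs]
  refine mul_le_mul_of_nonneg_left ((norm_add_le _ _).trans (add_le_add (h1.trans ?_) h3))
    (abs_nonneg _)
  exact mul_le_mul_of_nonneg_left (add_le_add_right h2 _) hL0.le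

/-- `d` contains the unrelaxed `xt`, so its increments are not directly of order `γ`. But `xt` is a
Lipschitz function of `x` and the mixed `σ`, `z`, whose changes are controlled; `y` does not enter,
so there is no circularity. -/
theorem IsTrajectory.summable_increment_d (h : g.IsTrajectory α β W γ x xt σ lam lt y z d)
    (hg : g.Standard) (hγ : VanishingSteps γ) (hW : MixesGeometrically W C ρ)
    (hbσ : IsTrackingBound W C ρ σ x bσ) (hbz : IsTrackingBound W C ρ z lam bz)
    {S : Set (Vec n)} (hL : g.LipschitzOver S) {K : ℕ}
    (hK : ∀ k ≥ K, mix (W k) (σ k) ∈ prodSet fun _ : Fin N => S)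
    (hx : Summable fun k => γ k * increment x k) (hl : Summable fun k => γ k * increment lam k) :
    Summable fun k => γ k * increment d k := by
  obtain ⟨L, hL0, hL⟩ := hL.exists_block
  obtain ⟨s1, s2⟩ := hbσ.summable hW hγ.nonneg hγ.anti hx
  obtain ⟨t1, t2⟩ := hbz.summable hW hγ.nonneg hγ.anti hl
  -- `d 0` comes from the initialization, so the formula for `d` applies to both ends of an
  -- increment only from index `1` on.
  rw [← summable_nat_add_iff 1]
  simp only [increment, Finset.mul_sum]
  refine summable_sum fun i _ => ?_
  have hs : Summable fun k => γ k * (‖g.C i‖ * (2 * (increment x k + |α i| *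
      (L * (increment x k + N * (bσ (k + 1) + bσ k + increment x k))
        + ‖g.C i‖ * (bz (k + 1) + bz k + increment lam k))) + increment x k)) := by
    refine (((hx.mul_left (‖g.C i‖ * (2 * (1 + |α i| * L * (1 + N)) + 1))).add
      ((s1.add s2).mul_left (‖g.C i‖ * (2 * |α i| * L * N)))).add
      (((t1.add t2).add hl).mul_left (‖g.C i‖ * (2 * |α i| * ‖g.C i‖)))).congr fun k => ?_
    ring
  refine Summable.of_norm_bounded_eventually_nat hs ?_
  filter_upwards [eventually_ge_atTop K] with k hk
  rw [Real.norm_of_nonneg (mul_nonneg (hγ.nonneg _) (norm_nonneg _))]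
  refine mul_le_mul (hγ.anti k) ?_ (norm_nonneg _) (hγ.nonneg k)
  have h1 := h.norm_xt_succ_sub_le hg hγ hbσ hbz hL0 hL (hK k hk) (hK (k + 1) (by omega)) i
  rw [h.d_succ, h.d_succ, ← map_sub]
  refine ((g.C i).le_opNorm _).trans (mul_le_mul_of_nonneg_left ?_ (norm_nonneg _))
  have e1 : (2 : ℝ) • xt (k + 1) i - x (k + 1) i - ((2 : ℝ) • xt k i - x k i)
      = (2 : ℝ) • (xt (k + 1) i - xt k i) - (x (k + 1) i - x k i) := by module
  rw [e1]
  refine (norm_sub_le _ _).trans ?_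
  rw [norm_smul, Real.norm_two]
  linarith [norm_sub_le_increment x k i]

/-- The error of the distributed iteration against the forward-backward step with exact averages:
the disagreement of the estimates. -/
def consensusError (g : AggGame N n m) (W : ℕ → Matrix (Fin N) (Fin N) ℝ)
    (x σ : ℕ → Stack N n) (lam y z : ℕ → Stack N m) (k : ℕ) : PrimalDual N n m :=
  WithLp.toLp 2
    (col fun i => g.partialGrad i (x k i) (mix (W k) (σ k) i) - g.pseudoGrad (x k) i
      + (g.C i).adjoint (mix (W k) (z k) i - avg (lam k)),
    col fun i => avg (y (k + 1)) - y (k + 1) i + (avg (lam k) - mix (W k) (z k) i))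

theorem norm_primalDual_le (w : PrimalDual N n m) :
    ‖w‖ ≤ ∑ i, ‖w.fst i‖ + ∑ i, ‖w.snd i‖ := by
  have h1 : ‖w‖ ≤ ‖w.fst‖ + ‖w.snd‖ := by
    rw [WithLp.prod_norm_eq_of_L2]
    refine Real.sqrt_le_iff.2 ⟨by positivity, ?_⟩
    nlinarith [mul_nonneg (norm_nonneg w.fst) (norm_nonneg w.snd)]
  exact h1.trans (add_le_add (norm_le_sum_norm _) (norm_le_sum_norm _))

theorem IsTrajectory.summable_consensusError [NeZero N]
    (h : g.IsTrajectory α β W γ x xt σ lam lt y z d)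
    (hg : g.Standard) (hγ : VanishingSteps γ) (hW : MixesGeometrically W C ρ)
    (hbσ : IsTrackingBound W C ρ σ x bσ) (hbz : IsTrackingBound W C ρ z lam bz)
    {S : Set (Vec n)} (hL : g.LipschitzOver S) (hS : g.hull ⊆ S) {K : ℕ}
    (hK : ∀ k ≥ K, mix (W k) (σ k) ∈ prodSet fun _ : Fin N => S)
    (hx : Summable fun k => γ k * increment x k) (hl : Summable fun k => γ k * increment lam k) :
    Summable fun k => γ k * ‖g.consensusError W x σ lam y z k‖ := by
  have hd := h.summable_increment_d hg hγ hW hbσ hbz hL hK hx hl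
  obtain ⟨bd, hbd⟩ := hW.exists_isTrackingBound h.y_succ
  obtain ⟨L, hL0, hL⟩ := hL.exists_block
  obtain ⟨s1, -⟩ := hbσ.summable hW hγ.nonneg hγ.anti hx
  obtain ⟨t1, -⟩ := hbz.summable hW hγ.nonneg hγ.anti hl
  obtain ⟨-, u2⟩ := hbd.summable hW hγ.nonneg hγ.anti hd
  have hs : Summable fun k => γ k * (∑ i, (L * (N * bσ k) + ‖g.C i‖ * bz k)
      + ∑ _i : Fin N, (bd (k + 1) + bz k)) := by
    refine (((s1.mul_left (N * (L * N))).add (t1.mul_left ((∑ i, ‖g.C i‖) + N))).add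
      (u2.mul_left (N : ℝ))).congr fun k => ?_
    simp only [Finset.sum_add_distrib, Finset.sum_const, Finset.card_univ, Fintype.card_fin,
      nsmul_eq_mul, ← Finset.sum_mul]
    ring
  refine Summable.of_norm_bounded_eventually_nat hs ?_
  filter_upwards [eventually_ge_atTop K] with k hk
  rw [Real.norm_of_nonneg (mul_nonneg (hγ.nonneg _) (norm_nonneg _))]
  refine mul_le_mul_of_nonneg_left ((norm_primalDual_le _).trans (add_le_add
    (Finset.sum_le_sum fun i _ => ?_) (Finset.sum_le_sum fun i _ => ?_))) (hγ.nonneg k)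
  · simp only [consensusError, WithLp.toLp_fst, col_apply]
    have hxk := h.x_mem_all hg hγ k
    refine (norm_add_le _ _).trans (add_le_add ?_ ?_)
    · rw [pseudoGrad_apply hg hxk]
      refine (hL _ hxk _ hxk _ (hK k hk) (col fun _ => avg (x k))
        (fun _ => hS (avg_mem_hull hxk)) i).trans (mul_le_mul_of_nonneg_left ?_ hL0.le)
      simp only [sub_self, norm_zero, Finset.sum_const_zero, zero_add, col_apply]
      refine (Finset.sum_le_sum fun j _ => ?_).trans_eq (b := ∑ _j : Fin N, bσ k) (by simp)
      rw [← h.avg_σ hW]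
      exact hbσ.norm_mix_sub_le k j
    · rw [← h.avg_z hW]
      exact (norm_adjoint_apply_le i _).trans
        (mul_le_mul_of_nonneg_left (hbz.norm_mix_sub_le k i) (norm_nonneg _))
  · simp only [consensusError, WithLp.toLp_snd, col_apply]
    refine (norm_add_le _ _).trans (add_le_add ?_ ?_)
    · rw [norm_sub_rev]
      exact hbd.norm_sub_le _ _
    · rw [norm_sub_rev, ← h.avg_z hW]
      exact hbz.norm_mix_sub_le k i

theorem inner_le_of_eq_proj {e : ℕ} {S : Set (Vec e)} (hcl : IsClosed S) (hconv : Convex ℝ S)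
    {a : ℝ} (ha : 0 < a) {u v p ζ : Vec e} (hv : v = proj S (u + a • p)) (hζ : ζ ∈ S) :
    inner ℝ (a⁻¹ • (u - v) + p) (ζ - v) ≤ 0 := by
  have h1 := inner_sub_proj_le hcl hconv (x := u + a • p) hζ
  rw [← hv] at h1
  have h2 : a⁻¹ • (u - v) + p = a⁻¹ • (u + a • p - v) := by
    rw [add_sub_right_comm, smul_add, inv_smul_smul₀ ha.ne']
  rw [h2, real_inner_smul_left]
  exact mul_nonpos_of_nonneg_of_nonpos (by positivity) h1

/-- The preconditioner is made for this. Its coupling part combines with the skew part so that the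
new dual average drops out of the primal block, and the dual block contains `2 x̃ - x`, the quantity
tracked by `y`. Both blocks become explicit projections. -/
theorem IsTrajectory.variational (h : g.IsTrajectory α β W γ x xt σ lam lt y z d)
    (hg : g.Standard) (hW : MixesGeometrically W C ρ) (hα : ∀ i, 0 < α i) (hβ : ∀ i, 0 < β i)
    (k : ℕ) {ζ : PrimalDual N n m} (hζ1 : ζ.fst ∈ prodSet g.Ω)
    (hζ2 : ζ.snd ∈ prodSet fun _ : Fin N => orthant m) :
    inner ℝ (g.precond α β (WithLp.toLp 2 (x k, lam k) - WithLp.toLp 2 (xt k, lt k))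
      - g.forwardOp (WithLp.toLp 2 (x k, lam k)) - g.couplingOp (-1) (WithLp.toLp 2 (xt k, lt k))
      - g.consensusError W x σ lam y z k) (ζ - WithLp.toLp 2 (xt k, lt k)) ≤ 0 := by
  have hy : avg (y (k + 1)) = (1 / (N : ℝ)) • ((2 : ℝ) • g.total (xt k) - g.total (x k))
      - (1 / (N : ℝ)) • ∑ i, g.c i := by
    rw [h.avg_y hW, avg, avg]
    simp only [h.d_succ, map_sub, map_smul, Finset.sum_sub_distrib, ← Finset.smul_sum, total,
      col_apply]
  have e1 : g.precond α β (WithLp.toLp 2 (x k, lam k) - WithLp.toLp 2 (xt k, lt k))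
      - g.forwardOp (WithLp.toLp 2 (x k, lam k)) - g.couplingOp (-1) (WithLp.toLp 2 (xt k, lt k))
      - g.consensusError W x σ lam y z k
      = WithLp.toLp 2 (col fun i => (α i)⁻¹ • (x k i - xt k i)
          + -(g.partialGrad i (x k i) (mix (W k) (σ k) i) + (g.C i).adjoint (mix (W k) (z k) i)),
        col fun i => (β i)⁻¹ • (lam k i - lt k i)
          + (y (k + 1) i - lam k i + mix (W k) (z k) i)) := by
    refine primalDual_ext (fun i => ?_) (fun i => ?_)
    · simp only [precond, forwardOp, couplingOp, consensusError, LinearMap.coe_mk, AddHom.coe_mk,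
        WithLp.sub_fst, WithLp.toLp_fst, WithLp.toLp_snd, PiLp.sub_apply, col_apply, map_sub]
      module
    · simp only [precond, forwardOp, couplingOp, consensusError, LinearMap.coe_mk, AddHom.coe_mk,
        WithLp.sub_fst, WithLp.sub_snd, WithLp.toLp_fst, WithLp.toLp_snd, PiLp.sub_apply,
        PiLp.add_apply, PiLp.smul_apply, col_apply, total_sub, hy]
      module
  rw [e1, primalDual_inner, stack_inner, stack_inner]
  refine add_nonpos (Finset.sum_nonpos fun i _ => ?_) (Finset.sum_nonpos fun i _ => ?_)
  · refine inner_le_of_eq_proj (hg.compact i).isClosed (hg.convex i) (hα i) ?_ (hζ1 i)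
    rw [smul_neg, ← sub_eq_add_neg]
    exact h.xt_eq k i
  · exact inner_le_of_eq_proj (isClosed_orthant m) (convex_orthant m) (hβ i) (h.lt_eq k i) (hζ2 i)

theorem isZeroT_of_forwardBackward {w : PrimalDual N n m} (h1 : w.fst ∈ prodSet g.Ω)
    (h2 : w.snd ∈ prodSet fun _ : Fin N => orthant m)
    (h : ∀ ζ : PrimalDual N n m, ζ.fst ∈ prodSet g.Ω →
      ζ.snd ∈ (prodSet fun _ : Fin N => orthant m) →
      0 ≤ inner ℝ (g.forwardOp w + g.couplingOp (-1) w) (ζ - w)) : g.IsZeroT w.fst w.snd := by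
  refine isZeroT_of_variational h1 h2 (fun u hu => ?_) (fun u hu => ?_)
  · have h3 := h (WithLp.toLp 2 (u, w.snd)) hu h2
    rw [primalDual_inner] at h3
    simp only [WithLp.sub_fst, WithLp.sub_snd, WithLp.toLp_fst, WithLp.toLp_snd, sub_self,
      inner_zero_right, add_zero, WithLp.add_fst] at h3
    convert h3 using 2
    refine PiLp.ext fun i => ?_
    simp [forwardOp, couplingOp, avg]
  · have h3 := h (WithLp.toLp 2 (w.fst, u)) h1 hu
    rw [primalDual_inner] at h3
    simp only [WithLp.sub_fst, WithLp.sub_snd, WithLp.toLp_fst, WithLp.toLp_snd, sub_self,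
      inner_zero_right, zero_add, WithLp.add_snd] at h3
    convert h3 using 2
    refine PiLp.ext fun i => ?_
    simp only [forwardOp, couplingOp, LinearMap.coe_mk, AddHom.coe_mk, WithLp.toLp_snd,
      PiLp.sub_apply, PiLp.add_apply, PiLp.smul_apply, col_apply, coupling_eq_total]
    module

end AggGame

theorem theorem2 {N n m : ℕ} (g : AggGame N n m) (hg : g.Standard)
    (χ : ℝ) (hχ : 0 < χ) (hF : g.Cocoercive χ)
    (hL : g.LipschitzOver g.hull)
    (G : ℕ → SimpleGraph (Fin N)) (hG : QConnected G)
    (W : ℕ → Matrix (Fin N) (Fin N) ℝ) (hW : IsMixing G W)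
    (δ τ : ℝ) (α β : Fin N → ℝ) (hαβ : g.StepSizes χ δ τ α β)
    (γ : ℕ → ℝ) (hγ : VanishingSteps γ)
    -- only in the borderline case `γ^0 = 1`: Lipschitz continuity a little beyond the hull
    (hL' : γ 0 = 1 → ∃ r : ℝ, 0 < r ∧ g.LipschitzOver (Metric.thickening r g.hull))
    (xm xtm x0 : Stack N n) (hxm : xm ∈ prodSet g.Ω) (hxtm : xtm ∈ prodSet g.Ω)
    (hx0 : x0 ∈ prodSet g.Ω)
    (l0 : Stack N m) (hl0 : l0 ∈ prodSet fun _ : Fin N => orthant m)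
    (hbdd : ∃ B : ℝ, 0 < B ∧ ∀ k, ‖(g.alg α β W γ xm xtm x0 l0 k).lam‖ ≤ B) :
    ∃ (xs : Stack N n) (ls : Stack N m),
      Tendsto (fun k => ((g.alg α β W γ xm xtm x0 l0 k).x, (g.alg α β W γ xm xtm x0 l0 k).lam))
        atTop (𝓝 (xs, ls)) ∧
      g.IsZeroT xs ls ∧ g.IsVariationalGNE xs := by
  have : NeZero N := by
    obtain ⟨Q, -, hQ⟩ := hG
    obtain ⟨i⟩ := (hQ 0).nonempty
    exact ⟨(i.pos).ne'⟩
  obtain ⟨⟨C, ρ, hM⟩, ε, hε, hε1, hdiag⟩ := hW.exists_mixesGeometrically hG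
  obtain ⟨B, -, hB⟩ := hbdd
  obtain ⟨xt, σ, lt, y, z, d, h⟩ := g.isTrajectory_alg α β W γ (xm := xm) (xtm := xtm) hx0 hl0
  set x : ℕ → Stack N n := fun k => (g.alg α β W γ xm xtm x0 l0 k).x
  set lam : ℕ → Stack N m := fun k => (g.alg α β W γ xm xtm x0 l0 k).lam
  obtain ⟨R, -, hR⟩ := hg.exists_norm_le
  obtain ⟨Rl, hRl⟩ := h.exists_norm_lt_le hg hγ hM hB
  have hxR : ∀ k i, ‖x k i‖ ≤ R := fun k => hR _ (h.x_mem_all hg hγ k)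
  have hxtR : ∀ k i, ‖xt k i‖ ≤ R := fun k => hR _ (h.xt_mem hg k)
  have hlR : ∀ k i, ‖lam k i‖ ≤ max B Rl := fun k i =>
    ((norm_block_le _ _).trans (hB k)).trans (le_max_left _ _)
  have hltR : ∀ k i, ‖lt k i‖ ≤ max B Rl := fun k i => (hRl k i).trans (le_max_right _ _)
  have hix := increment_le_of_relaxation hγ.nonneg h.x_succ hxR hxtR
  have hil := increment_le_of_relaxation hγ.nonneg h.lam_succ hlR hltR
  -- Square-summability of `γ` enters here: `γ` times the increment is at most `c * γ ^ 2`.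
  have hsum : ∀ {e : ℕ} {p : ℕ → Stack N e} {c : ℝ}, (∀ k, increment p k ≤ γ k * c) →
      Summable fun k => γ k * increment p k := fun {e p c} hp =>
    Summable.of_nonneg_of_le (fun k => mul_nonneg (hγ.nonneg k) (increment_nonneg p k))
      (fun k => (mul_le_mul_of_nonneg_left (hp k) (hγ.nonneg k)).trans_eq (by ring))
      (hγ.sq_summable.mul_right c)
  obtain ⟨bσ, hbσ⟩ := hM.exists_isTrackingBound h.σ_succ
  obtain ⟨bz, hbz⟩ := hM.exists_isTrackingBound h.z_succ
  have hbσ0 : Tendsto bσ atTop (𝓝 0) := hbσ.tendsto_zero hM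
    (squeeze_zero (increment_nonneg x) hix (by simpa using hγ.tendsto_zero.mul_const _))
  obtain ⟨S, hLS, hS, K, hK⟩ :=
    h.exists_lipschitzOver hg hγ hM hε hε1 hdiag hL hL' hbσ hbσ0
  have herr := h.summable_consensusError hg hγ hM hbσ hbz hLS hS hK (hsum hix) (hsum hil)
  have hnorm : ∀ (u : Stack N n) (v : Stack N m), (∀ i, ‖u i‖ ≤ R) → (∀ i, ‖v i‖ ≤ max B Rl) →
      ‖(WithLp.toLp 2 (u, v) : AggGame.PrimalDual N n m)‖ ≤ N * R + N * max B Rl := by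
    intro u v hu hv
    refine (AggGame.norm_primalDual_le _).trans (add_le_add
      ((Finset.sum_le_sum fun i _ => hu i).trans_eq ?_)
      ((Finset.sum_le_sum fun i _ => hv i).trans_eq ?_)) <;> simp
  obtain ⟨w, hw, hlim, hsol⟩ := tendsto_inexact_forwardBackward
    (D := {w : AggGame.PrimalDual N n m | w.fst ∈ prodSet g.Ω ∧
      w.snd ∈ prodSet fun _ : Fin N => orthant m})
    (((isClosed_prodSet fun i => (hg.compact i).isClosed).preimage
        (WithLp.continuous_fst 2 _ _)).inter
      ((isClosed_prodSet fun _ => isClosed_orthant m).preimage (WithLp.continuous_snd 2 _ _)))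
    (fun u hu v hv a b ha hb hab => ⟨convex_prodSet hg.convex hu.1 hv.1 ha hb hab,
      convex_prodSet (fun _ => convex_orthant m) hu.2 hv.2 ha hb hab⟩)
    (P := g.precond α β) (A := g.couplingOp (-1)) (B := g.forwardOp) hαβ.δ_pos hαβ.τ_gt
    (g.isSymmetric_precond α β) (g.le_inner_precond hαβ)
    (fun u => by rw [g.inner_couplingOp, real_inner_comm]; ring)
    (fun u hu v hv => g.cocoercive_forwardOp hαβ.δ_le hF hu.1 hv.1)
    (w := fun k => WithLp.toLp 2 (x k, lam k)) (wt := fun k => WithLp.toLp 2 (xt k, lt k))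
    (fun k => ⟨h.x_mem_all hg hγ k, h.lam_mem_all hγ k⟩) (fun k => ⟨h.xt_mem hg k, h.lt_mem k⟩)
    (fun k => hnorm _ _ (hxR k) (hlR k)) (fun k => hnorm _ _ (hxtR k) (hltR k))
    (fun k ζ hζ => h.variational hg hM hαβ.α_pos hαβ.β_pos k hζ.1 hζ.2)
    (fun k => AggGame.primalDual_ext (fun i => by simp [h.x_succ]) (fun i => by simp [h.lam_succ]))
    hγ.nonneg hγ.le_one hγ.not_summable herr
  have hzero : g.IsZeroT w.fst w.snd :=
    AggGame.isZeroT_of_forwardBackward hw.1 hw.2 fun ζ h1 h2 => hsol ζ ⟨h1, h2⟩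
  refine ⟨w.fst, w.snd, ?_, hzero, AggGame.isVariationalGNE_of_isZeroT hg hzero⟩
  exact (((WithLp.continuous_fst 2 _ _).tendsto w).comp hlim).prodMk_nhds
    (((WithLp.continuous_snd 2 _ _).tendsto w).comp hlim)
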